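/- Let $\mathbf H$ be a complex Hilbert space and let $D_1,\dots,D_d$ be the generators of strongly continuous contraction semigroups $T_1(t),\dots,T_d(t)$, $t\ge 0$, on $\mathbf H$. For $k\in\mathbb N\cup\{0\}$ let $\mathbf H^k$ be the space of all $f\in\mathbf H$ for which every $D_{j_1}\cdots D_{j_i}f$ with $0\le i\le k$, $1\le j_1,\dots,j_i\le d$, exists. Put $Tf(t_1,\dots,t_d)=T_1(t_1)\cdots T_d(t_d)f$ for $t_1,\dots,t_d\ge 0$, and let $U$ be the open Euclidean unit ball of $\mathbb R^d$. Assume: (a) $\mathbf H^1=\bigcap_i\mathcal D(D_i)$ is dense in $\mathbf H$; (b) $T_i(t)\mathbf H^1\subset\mathbf H^1$ for all $1\le i\le d$, $t\ge0$; (c) there are functions $\zeta_i^k\in C^\infty(U)$ such that $D_iTf(t)=\sum_{k=1}^d\zeta_i^k(t)\,(\partial_kTf)(t)$ for all $1\le i\le d$, $f\in\mathbf H^1$ and $t\in U\cap[0,\infty)^d$ (one-sided derivatives where $t_k=0$). Let $r\ge1$ be an integer. For $s>0$ and $f\in\mathbf H$ define $$H_{j,r}(s)f=(s/r)^{-r}\int_0^{s/r}\!\!\cdots\int_0^{s/r}\sum_{k=1}^r(-1)^k\binom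 rk T_j\big(k(\tau_{j,1}+\dots+\tau_{j,r})\big)f\,d\tau_{j,1}\cdots d\tau_{j,r},$$ $$H_r(s)f=H_{1,r}(s)H_{2,r}(s)\cdots H_{d,r}(s)f .$$ 1. For every $f\in\mathbf H$ and every $s>0$ with $\sqrt d\,r\,s<1$ one has $H_r(s)f\in\mathbf H^r$. 2. Let $0\le q\le r$, $1\le j_1,\dots,j_q\le d$, and let $s_0>0$ satisfy $\sqrt d\,r\,s_0<1$. Then there are finitely many terms, indexed by $\nu$, each given by a constant $a_\nu\in\mathbb C$; integers $1\le k_1,\dots,k_d\le r$; a set $M$ of $m$ of the $rd$ variables $\tau_{i,\kappa}$ ($1\le i\le d$, $1\le\kappa\le r$); distinct variables $\tau_{i_1,\kappa_1},\dots,\tau_{i_l,\kappa_l}$ in $M$ (so $0\le l\le m\le rd$); and functions $\mu_{\nu,s}\in C^\infty(\mathbb R^{rd})$, $0<s\le s_0$; and there are constants $c_p$, $p\in\mathbb N\cup\{0\}$, independent of $s$, such that $$\max_{0\le\tau_{i,\kappa}\le s}|\partial^p\mu_{\nu,s}|\le c_p\,s^{m-l}\qquad(0<s\le s_0,\ p\in\mathbb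 N\cup\{0\})$$ and such that for all $f\in\mathbf H$ and $0<s\le s_0$ the vector $D_{j_1}\cdots D_{j_q}H_r(s)f$ exists, lies in $\mathbf H^{r-q}$, and equals $\sum_\nu a_\nu I_\nu(s)f$, where $$I_\nu(s)f=(s/r)^{-rd}\underbrace{\int_0^{s/r}\!\!\cdots\int_0^{s/r}}_{rd-m}\mu_{\nu,s}\,\Delta_{i_1,\kappa_1}(s/r)\cdots\Delta_{i_l,\kappa_l}(s/r)F ,\qquad F(\tau)=Tf\Big(k_1\sum_\kappa\tau_{1,\kappa},\dots,k_d\sum_\kappa\tau_{d,\kappa}\Big),$$ and every $I_\nu(s)f$ lies in $\mathbf H^{r-q}$. Here $\Delta_{i,\kappa}(\sigma)F$ is the value of $F$ at $\tau_{i,\kappa}=\sigma$ minus its value at $\tau_{i,\kappa}=0$ (the other variables unchanged), the integration is over the $rd-m$ variables outside $M$, and the integrand is taken with the variables in $M$ equal to $0$. The data $a_\nu,k_j,M,(i_\cdot,\kappa_\cdot),\mu_{\nu,s},c_p$ do not depend on $f$. -/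

import Mathlib

open Set Filter Topology MeasureTheory
open scoped ContDiff

namespace HardySteklov

variable {H : Type*} [NormedAddCommGroup H] [InnerProductSpace ℂ H]

/-- `T` restricted to `[0, ∞)` is a strongly continuous one-parameter semigroup of contractions
(the values of `T` at negative times are irrelevant and never used). -/
structure IsContractionSemigroup (T : ℝ → H →L[ℂ] H) : Prop where
  map_zero : T 0 = ContinuousLinearMap.id ℂ H
  map_add : ∀ s t : ℝ, 0 ≤ s → 0 ≤ t → T (s + t) = (T s).comp (T t)
  norm_le_one : ∀ t : ℝ, 0 ≤ t → ‖T t‖ ≤ 1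
  strongly_continuous : ∀ f : H, ContinuousOn (fun t : ℝ => T t f) (Ici 0)

/-- The graph of the infinitesimal generator `D` of the semigroup `T`:
`f` lies in the domain of `D` and `D f = g`, that is `g = lim_{h → 0+} h⁻¹ (T(h) f - f)`. -/
def IsGeneratorValue (T : ℝ → H →L[ℂ] H) (f g : H) : Prop :=
  Tendsto (fun h : ℝ => h⁻¹ • (T h f - f)) (𝓝[>] (0 : ℝ)) (𝓝 g)

/-- For a word `[j₁, …, j_q]`: the vector `f` lies in the domain of the composition
`D_{j₁} ⋯ D_{j_q}` of generators (`D_{j_q}` acts first), and `D_{j₁} ⋯ D_{j_q} f = g`. -/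
def IsMixedDerivative {d : ℕ} (T : Fin d → ℝ → H →L[ℂ] H) : List (Fin d) → H → H → Prop
  | [], f, g => g = f
  | j :: js, f, g => ∃ h : H, IsMixedDerivative T js f h ∧ IsGeneratorValue (T j) h g

/-- The abstract Sobolev space `H^r`: all the vectors `D_{j₁} ⋯ D_{j_k} f` with `k ≤ r` exist. -/
def sobolev {d : ℕ} (T : Fin d → ℝ → H →L[ℂ] H) (r : ℕ) : Set H :=
  {f | ∀ js : List (Fin d), js.length ≤ r → ∃ g : H, IsMixedDerivative T js f g}

/-- `Tf(t₁, …, t_d) = T₁(t₁) T₂(t₂) ⋯ T_d(t_d) f`. -/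
def orbit {d : ℕ} (T : Fin d → ℝ → H →L[ℂ] H) (f : H) (t : Fin d → ℝ) : H :=
  (List.finRange d).foldr (fun j g => T j (t j) g) f

/-- The partial derivative `∂_k Tf` at a point `t` with nonnegative coordinates
(one-sided when `t_k = 0`). -/
noncomputable def orbitPartial {d : ℕ} (T : Fin d → ℝ → H →L[ℂ] H) (f : H) (k : Fin d)
    (t : Fin d → ℝ) : H :=
  derivWithin (fun x : ℝ => orbit T f (Function.update t k x)) (Ici 0) (t k)

/-- The standard open Euclidean unit ball of `ℝ^d`. -/
def unitBall (d : ℕ) : Set (Fin d → ℝ) := {t | ∑ i, t i ^ 2 < 1}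

/-- The standing assumptions on the semigroups `T₁, …, T_d` with generators `D₁, …, D_d`. -/
structure Admissible {d : ℕ} (T : Fin d → ℝ → H →L[ℂ] H) : Prop where
  semigroup : ∀ i, IsContractionSemigroup (T i)
  /-- `H¹`, the intersection of the domains of the generators, is dense. -/
  dense_sobolev_one : Dense (sobolev T 1)
  /-- `H¹` is invariant under all the semigroups. -/
  invariant : ∀ (i : Fin d) (t : ℝ), 0 ≤ t → ∀ f ∈ sobolev T 1, T i t f ∈ sobolev T 1
  /-- `D_i Tf(t) = ∑_k ζ_i^k(t) (∂_k Tf)(t)` on the unit ball, with smooth coefficients. -/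
  structure_formula : ∃ ζ : Fin d → Fin d → (Fin d → ℝ) → ℂ,
    (∀ i k, ContDiffOn ℝ ∞ (ζ i k) (unitBall d)) ∧
    ∀ (i : Fin d), ∀ f ∈ sobolev T 1, ∀ t ∈ unitBall d, (∀ j, 0 ≤ t j) →
      IsGeneratorValue (T i) (orbit T f t) (∑ k, ζ i k t • orbitPartial T f k t)

/-- The one-directional operator `H_{j,r}(s)` built from the single semigroup `T = T_j`:
`(s/r)^{-r} ∫_{[0,s/r]^r} ∑_{k=1}^r (-1)^k C(r,k) T(k(τ₁ + ⋯ + τ_r)) f dτ`. -/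
noncomputable def hardySteklovOne (T : ℝ → H →L[ℂ] H) (r : ℕ) (s : ℝ) (f : H) : H :=
  ((s / r) ^ r)⁻¹ • ∫ τ in Set.pi univ (fun _ : Fin r => Icc (0 : ℝ) (s / r)),
    ∑ k ∈ Finset.Icc 1 r, ((-1 : ℝ) ^ k * (r.choose k : ℝ)) • T ((k : ℝ) * ∑ i, τ i) f

/-- The Hardy–Steklov operator `H_r(s) f = H_{1,r}(s) H_{2,r}(s) ⋯ H_{d,r}(s) f`. -/
noncomputable def hardySteklov {d : ℕ} (T : Fin d → ℝ → H →L[ℂ] H) (r : ℕ) (s : ℝ) (f : H) : H :=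
  (List.finRange d).foldr (fun j g => hardySteklovOne (T j) r s g) f

/-- The difference operator in the variable with index `i`: the difference of the values of `F`
with that variable set to `s` and to `0`. -/
def diffOp {ι : Type*} [DecidableEq ι] (i : ι) (s : ℝ) (F : (ι → ℝ) → H) : (ι → ℝ) → H :=
  fun x => F (Function.update x i s) - F (Function.update x i 0)

/-- The combinatorial data of one integral: the multipliers `k_j`, the `m` variables `τ_{i,κ}` over
which one does not integrate (`frozen`), and, among them, the `l` distinct variables in which a
difference is taken (`diffs`). -/
structure TermIndex (d r : ℕ) where
  mult : Fin d → ℕ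
  one_le_mult : ∀ j, 1 ≤ mult j
  mult_le : ∀ j, mult j ≤ r
  frozen : Finset (Fin d × Fin r)
  diffs : List (Fin d × Fin r)
  diffs_nodup : diffs.Nodup
  diffs_subset : ∀ x ∈ diffs, x ∈ frozen

namespace TermIndex

variable {d r : ℕ}

/-- The number `m` of variables over which one does not integrate. -/
def m (a : TermIndex d r) : ℕ := a.frozen.card

/-- The number `l` of difference operators. -/
def l (a : TermIndex d r) : ℕ := a.diffs.length

theorem l_le_m (a : TermIndex d r) : a.l ≤ a.m := by
  have h : a.diffs.toFinset ⊆ a.frozen := fun x hx => a.diffs_subset x (by simpa using hx)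
  simpa [l, m, List.toFinset_card_of_nodup a.diffs_nodup] using Finset.card_le_card h

/-- The function `Tf(k₁(τ_{1,1} + ⋯ + τ_{1,r}), …, k_d(τ_{d,1} + ⋯ + τ_{d,r}))` of the `rd`
variables `τ_{i,κ}`. -/
def orbitFun (a : TermIndex d r) (T : Fin d → ℝ → H →L[ℂ] H) (f : H)
    (τ : Fin d × Fin r → ℝ) : H :=
  orbit T f (fun j => (a.mult j : ℝ) * ∑ κ : Fin r, τ (j, κ))

/-- The product of the difference operators with step `σ`, one for each entry of `diffs`, applied
to the function `orbitFun`. -/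
def diffOrbitFun (a : TermIndex d r) (T : Fin d → ℝ → H →L[ℂ] H) (f : H) (σ : ℝ) :
    (Fin d × Fin r → ℝ) → H :=
  a.diffs.foldr (fun i F => diffOp i σ F) (a.orbitFun T f)

/-- The point of `ℝ^{rd}` with the given free coordinates and with all the frozen coordinates
equal to `0`. (A coordinate in which a difference is taken is overwritten by the difference
operator, so its value here does not matter for `diffOrbitFun`.) -/
def extend (a : TermIndex d r) (τ : {x : Fin d × Fin r // x ∉ a.frozen} → ℝ) :
    Fin d × Fin r → ℝ :=
  fun x => if h : x ∉ a.frozen then τ ⟨x, h⟩ else 0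

/-- The `(rd - m)`-fold integral
`(s/r)^{-rd} ∫_{[0,s/r]^{rd-m}} μ(·) Δ_{i₁,κ₁}(s/r) ⋯ Δ_{i_l,κ_l}(s/r) Tf(·) d·`. -/
noncomputable def integralTerm (a : TermIndex d r) (T : Fin d → ℝ → H →L[ℂ] H)
    (μ : (Fin d × Fin r → ℝ) → ℂ) (s : ℝ) (f : H) : H :=
  ((s / r) ^ (r * d))⁻¹ •
    ∫ τ in Set.pi univ (fun _ : {x : Fin d × Fin r // x ∉ a.frozen} => Icc (0 : ℝ) (s / r)),
      μ (a.extend τ) • a.diffOrbitFun T f (s / r) (a.extend τ)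

end TermIndex

end HardySteklov

/-! Expanding the product, `hardySteklov` is a finite combination of integrals of `Tf` over all `rd`
variables with constant coefficients and nothing frozen (`exists_mem_termSums_eq_hardySteklov`). The
theorem follows once a generator is shown to map integrals with at most `n < r` frozen variables to
sums of integrals with at most `n + 1`, with the right powers of `s` in the coefficients
(`exists_generator_step`); this step can be repeated `r` times.

For the step, assumption (c) turns `D_i Tf` into a combination of the `∂_k Tf` with smooth
coefficients. Since fewer than `r` variables are frozen, each row `k` keeps a free variable
`τ_{k,κ}`, and `∂_k Tf` is, up to the factor `k_k`, the derivative in that variable. After the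
coefficients have been moved out of the differences (`exists_leibniz`), integration by parts
(`exists_tendsto_by_parts`) leaves an interior term, where the derivative falls on the coefficient,
and a boundary term. The latter freezes `τ_{k,κ}` and splits into a difference of the orbit and a
difference of the coefficient. A difference of a coefficient gains a factor `s`, which accounts for
the order `s^(m-l)`.

The analytic difficulty is that, even for `f ∈ H¹`, the partial derivatives of the orbit are not
known to be bounded near the coordinate hyperplanes. The uniform boundedness principle on the graph
space and Baire's theorem bound them on compact subsets of the open orthant
(`exists_graphBound_Icc`). The integration by parts is therefore done with the free variables in
`[σθ, σ]`; then `θ → 0`, and closedness of the generators carries the identity to the limit. Density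
of `H¹` and closedness once more extend it to all `f`. -/

namespace HardySteklov

/-! ### Contraction semigroups and their generators -/

section Semigroup

variable {H : Type*} [NormedAddCommGroup H] [InnerProductSpace ℂ H] {T : ℝ → H →L[ℂ] H}

theorem IsContractionSemigroup.norm_apply_le (hT : IsContractionSemigroup T) {t : ℝ} (ht : 0 ≤ t)
    (f : H) : ‖T t f‖ ≤ ‖f‖ :=
  ((T t).le_of_opNorm_le (hT.norm_le_one t ht) f).trans (by simp)

theorem IsContractionSemigroup.apply_add (hT : IsContractionSemigroup T) {s t : ℝ} (hs : 0 ≤ s)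
    (ht : 0 ≤ t) (f : H) : T (s + t) f = T s (T t f) := by
  rw [hT.map_add s t hs ht]; rfl

theorem IsContractionSemigroup.apply_zero (hT : IsContractionSemigroup T) (f : H) :
    T 0 f = f := by
  rw [hT.map_zero]; rfl

/-- Joint strong continuity. -/
theorem IsContractionSemigroup.continuousOn_apply (hT : IsContractionSemigroup T) {X : Type*}
    [TopologicalSpace X] {S : Set X} {u : X → ℝ} {g : X → H} (hu : ContinuousOn u S)
    (hg : ContinuousOn g S) (h0 : ∀ x ∈ S, 0 ≤ u x) :
    ContinuousOn (fun x => T (u x) (g x)) S := by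
  intro x hx
  have h1 : Tendsto (fun y => T (u y) (g x)) (𝓝[S] x) (𝓝 (T (u x) (g x))) :=
    ((hT.strongly_continuous (g x)).comp hu h0) x hx
  have h2 : Tendsto (fun y => T (u y) (g y - g x)) (𝓝[S] x) (𝓝 0) := by
    have h3 : Tendsto (fun y => ‖g y - g x‖) (𝓝[S] x) (𝓝 0) :=
      tendsto_iff_norm_sub_tendsto_zero.1 (hg x hx)
    refine squeeze_zero_norm' ?_ h3
    filter_upwards [self_mem_nhdsWithin] with y hy using hT.norm_apply_le (h0 y hy) _
  have h4 := h1.add h2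
  simpa [ContinuousWithinAt] using h4

theorem IsContractionSemigroup.continuous_apply (hT : IsContractionSemigroup T) {X : Type*}
    [TopologicalSpace X] {u : X → ℝ} {g : X → H} (hu : Continuous u)
    (hg : Continuous g) (h0 : ∀ x, 0 ≤ u x) : Continuous (fun x => T (u x) (g x)) :=
  continuousOn_univ.1 (hT.continuousOn_apply hu.continuousOn hg.continuousOn fun x _ => h0 x)

theorem IsContractionSemigroup.continuous_max (hT : IsContractionSemigroup T) (g : H) :
    Continuous fun t : ℝ => T (max t 0) g :=
  hT.continuous_apply (by fun_prop) continuous_const fun _ => le_max_right _ _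

theorem IsGeneratorValue.add {f g f' g' : H} (h : IsGeneratorValue T f g)
    (h' : IsGeneratorValue T f' g') : IsGeneratorValue T (f + f') (g + g') := by
  refine (Tendsto.add h h').congr fun t => ?_
  rw [map_add, ← smul_add]; congr 1; abel

theorem IsGeneratorValue.smul {f g : H} (c : ℂ) (h : IsGeneratorValue T f g) :
    IsGeneratorValue T (c • f) (c • g) := by
  refine (Tendsto.const_smul h c).congr fun t => ?_
  rw [map_smul, ← smul_sub, smul_comm]

theorem IsGeneratorValue.real_smul {f g : H} (c : ℝ) (h : IsGeneratorValue T f g) :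
    IsGeneratorValue T (c • f) (c • g) := by
  simpa using h.smul (c : ℂ)

theorem IsGeneratorValue.sub {f g f' g' : H} (h : IsGeneratorValue T f g)
    (h' : IsGeneratorValue T f' g') : IsGeneratorValue T (f - f') (g - g') := by
  simpa [sub_eq_add_neg] using h.add (h'.smul (-1))

theorem IsGeneratorValue.zero : IsGeneratorValue T (0 : H) 0 := by
  simp [IsGeneratorValue]

variable [CompleteSpace H]

/-- The semigroup law gives `t ↦ T t f` the right derivative `T t g`, and a continuous right
derivative suffices for the fundamental theorem of calculus. Writing `max s 0` makes the integrand
continuous on all of `ℝ`. -/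
theorem IsGeneratorValue.integral_eq (hT : IsContractionSemigroup T) {f g : H}
    (h : IsGeneratorValue T f g) {t : ℝ} (ht : 0 ≤ t) :
    ∫ s in (0 : ℝ)..t, T (max s 0) g = T t f - f := by
  have key := intervalIntegral.integral_eq_sub_of_hasDeriv_right (a := 0) (b := t)
    (f := fun s => T (max s 0) f) (f' := fun s => T (max s 0) g)
    (hT.continuous_max f).continuousOn ?_ ((hT.continuous_max g).intervalIntegrable _ _)
  · simpa [max_eq_left ht, hT.apply_zero] using key
  · intro x hx
    have hx0 : 0 ≤ x := by
      rw [min_eq_left ht] at hx; exact hx.1.le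
    rw [hasDerivWithinAt_iff_tendsto_slope' (by simp)]
    have h1 : Tendsto (fun y : ℝ => y - x) (𝓝[>] x) (𝓝[>] 0) := by
      refine tendsto_nhdsWithin_iff.2 ⟨?_, ?_⟩
      · have : Tendsto (fun y : ℝ => y - x) (𝓝 x) (𝓝 (x - x)) := by
          exact (continuous_id.sub continuous_const).tendsto x
        rw [sub_self] at this
        exact this.mono_left nhdsWithin_le_nhds
      · filter_upwards [self_mem_nhdsWithin] with y hy
        exact sub_pos.2 (mem_Ioi.1 hy)
    have h2 := ((T x).continuous.tendsto g).comp (Tendsto.comp h h1)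
    rw [max_eq_left hx0]
    refine h2.congr' ?_
    filter_upwards [self_mem_nhdsWithin] with y hy
    have hy' : x < y := hy
    simp only [Function.comp, slope, vsub_eq_sub]
    rw [max_eq_left hx0, max_eq_left (hx0.trans hy'.le)]
    rw [← Complex.coe_smul, map_smul, map_sub, ← hT.apply_add hx0 (sub_nonneg.2 hy'.le),
      Complex.coe_smul]
    simp

theorem IsContractionSemigroup.hasDerivAt_integral (hT : IsContractionSemigroup T) (g : H)
    (t : ℝ) : HasDerivAt (fun t => ∫ s in (0 : ℝ)..t, T (max s 0) g) (T (max t 0) g) t :=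
  ((hT.continuous_max g).integral_hasStrictDerivAt 0 t).hasDerivAt

theorem IsGeneratorValue.hasDerivWithinAt (hT : IsContractionSemigroup T) {f g : H}
    (h : IsGeneratorValue T f g) {t : ℝ} (ht : 0 ≤ t) :
    HasDerivWithinAt (fun t => T t f) (T t g) (Ici 0) t := by
  have h1 := ((hT.hasDerivAt_integral g t).const_add f).hasDerivWithinAt (s := Ici 0)
  rw [max_eq_left ht] at h1
  refine h1.congr (fun y hy => ?_) ?_
  · rw [h.integral_eq hT hy]; simp
  · rw [h.integral_eq hT ht]; simp

/-- The integral identity, unlike the limit of difference quotients, is visibly stable under limits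
in `(f, g)`; closedness of the generator rests on it. -/
theorem isGeneratorValue_iff (hT : IsContractionSemigroup T) {f g : H} :
    IsGeneratorValue T f g ↔
      ∀ t : ℝ, 0 ≤ t → ∫ s in (0 : ℝ)..t, T (max s 0) g = T t f - f := by
  refine ⟨fun h t ht => h.integral_eq hT ht, fun h => ?_⟩
  have h1 := (hT.hasDerivAt_integral g 0).hasDerivWithinAt (s := Ioi 0)
  rw [hasDerivWithinAt_iff_tendsto_slope' (by simp)] at h1
  simp only [max_self, hT.apply_zero] at h1
  refine h1.congr' ?_
  filter_upwards [self_mem_nhdsWithin] with y hy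
  simp [slope, h y (le_of_lt hy)]

theorem IsGeneratorValue.norm_sub_le (hT : IsContractionSemigroup T) {f g : H}
    (h : IsGeneratorValue T f g) {t : ℝ} (ht : 0 ≤ t) : ‖T t f - f‖ ≤ t * ‖g‖ := by
  rw [← h.integral_eq hT ht]
  have := intervalIntegral.norm_integral_le_of_norm_le_const (a := 0) (b := t) (C := ‖g‖)
    (f := fun s => T (max s 0) g) fun x _ => hT.norm_apply_le (le_max_right _ _) g
  rwa [sub_zero, abs_of_nonneg ht, mul_comm] at this

/-- The generator of a contraction semigroup is closed. -/
theorem isClosed_isGeneratorValue (hT : IsContractionSemigroup T) :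
    IsClosed {p : H × H | IsGeneratorValue T p.1 p.2} := by
  simp only [isGeneratorValue_iff hT, ofPred_forall]
  refine isClosed_iInter fun t => isClosed_iInter fun ht => isClosed_eq ?_ (by fun_prop)
  -- By contractivity the integral is `t`-Lipschitz in the vector, so both sides of the identity are
  -- continuous.
  have hlip : ∀ a b : H, ‖(∫ s in (0 : ℝ)..t, T (max s 0) a) - ∫ s in (0 : ℝ)..t, T (max s 0) b‖
      ≤ t * ‖a - b‖ := by
    intro a b
    rw [← intervalIntegral.integral_sub ((hT.continuous_max a).intervalIntegrable _ _)
      ((hT.continuous_max b).intervalIntegrable _ _)]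
    have := intervalIntegral.norm_integral_le_of_norm_le_const (a := 0) (b := t) (C := ‖a - b‖)
      (f := fun s => T (max s 0) a - T (max s 0) b) fun x _ => by
        rw [← map_sub]; exact hT.norm_apply_le (le_max_right _ _) _
    rwa [sub_zero, abs_of_nonneg ht, mul_comm] at this
  have : LipschitzWith ⟨t, ht⟩ fun a : H => ∫ s in (0 : ℝ)..t, T (max s 0) a :=
    LipschitzWith.of_dist_le_mul fun a b => by
      rw [dist_eq_norm, dist_eq_norm]; exact hlip a b
  exact this.continuous.comp continuous_snd

theorem IsGeneratorValue.of_tendsto (hT : IsContractionSemigroup T) {X : Type*} {l : Filter X}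
    [l.NeBot] {u v : X → H} {f g : H} (h : ∀ᶠ x in l, IsGeneratorValue T (u x) (v x))
    (hu : Tendsto u l (𝓝 f)) (hv : Tendsto v l (𝓝 g)) : IsGeneratorValue T f g :=
  (isClosed_isGeneratorValue hT).mem_of_tendsto (hu.prodMk_nhds hv) h

/-- The generator may be applied under the integral sign. -/
theorem IsGeneratorValue.integral (hT : IsContractionSemigroup T) {X : Type*} [MeasurableSpace X]
    {m : Measure X} {P Q : X → H} (hP : Integrable P m)
    (h : ∀ x, IsGeneratorValue T (P x) (Q x)) (hQ : Integrable Q m) :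
    IsGeneratorValue T (∫ x, P x ∂m) (∫ x, Q x ∂m) := by
  -- The difference quotients of `P x` are bounded by `‖Q x‖` for every step, which is the
  -- integrable majorant.
  have key := tendsto_integral_filter_of_dominated_convergence (μ := m) (l := 𝓝[>] (0 : ℝ))
    (F := fun h x => h⁻¹ • (T h (P x) - P x)) (f := Q) (fun x => ‖Q x‖) ?_ ?_ hQ.norm ?_
  · refine key.congr fun t => ?_
    rw [integral_smul, integral_sub ((T t).integrable_comp hP) hP,
      (T t).integral_comp_comm hP]
  · exact Eventually.of_forall fun t =>
      ((((T t).integrable_comp hP).sub hP).smul t⁻¹).aestronglyMeasurable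
  · filter_upwards [self_mem_nhdsWithin] with t ht
    have ht' : 0 < t := ht
    refine Eventually.of_forall fun x => ?_
    rw [norm_smul, norm_inv, Real.norm_of_nonneg ht'.le, inv_mul_le_iff₀ ht']
    exact (h x).norm_sub_le hT ht'.le
  · exact Eventually.of_forall h

end Semigroup

/-! ### Local boundedness of the semigroups on `H¹` -/

section GraphSpace

variable {H : Type*} [NormedAddCommGroup H] [InnerProductSpace ℂ H] {d : ℕ}
  {T : Fin d → ℝ → H →L[ℂ] H}

theorem mem_sobolev_one {f : H} :
    f ∈ sobolev T 1 ↔ ∀ k, ∃ g, IsGeneratorValue (T k) f g := by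
  constructor
  · intro h k
    obtain ⟨g, f', hf', hg⟩ := h [k] (by simp)
    obtain rfl : f' = f := hf'
    exact ⟨g, hg⟩
  · intro h js hjs
    match js, hjs with
    | [], _ => exact ⟨f, rfl⟩
    | [k], _ =>
      obtain ⟨g, hg⟩ := h k
      exact ⟨g, f, rfl, hg⟩
    | _ :: _ :: _, hjs => simp at hjs

/-- The space `H¹` realised as the joint graph of the generators. -/
def graphSpace (T : Fin d → ℝ → H →L[ℂ] H) : Submodule ℂ (H × (Fin d → H)) where
  carrier := {p | ∀ k, IsGeneratorValue (T k) p.1 (p.2 k)}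
  add_mem' hp hq k := (hp k).add (hq k)
  zero_mem' _ := IsGeneratorValue.zero
  smul_mem' c _ hp k := (hp k).smul c

theorem mem_graphSpace {p : H × (Fin d → H)} :
    p ∈ graphSpace T ↔ ∀ k, IsGeneratorValue (T k) p.1 (p.2 k) := Iff.rfl

theorem fst_mem_sobolev_one {p : H × (Fin d → H)} (hp : p ∈ graphSpace T) :
    p.1 ∈ sobolev T 1 :=
  mem_sobolev_one.2 fun k => ⟨_, hp k⟩

theorem exists_mem_graphSpace {f : H} (hf : f ∈ sobolev T 1) : ∃ p ∈ graphSpace T, p.1 = f := by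
  choose g hg using mem_sobolev_one.1 hf
  exact ⟨(f, g), hg, rfl⟩

/-- The operator `T_m(t)` has norm at most `n` as an operator from `H¹` to the domains of the
generators, expressed by difference quotients. -/
def GraphBound (T : Fin d → ℝ → H →L[ℂ] H) (m : Fin d) (n : ℝ) (t : ℝ) : Prop :=
  ∀ p ∈ graphSpace T, ∀ k, ∀ h : ℝ, 0 < h →
    ‖h⁻¹ • (T k h (T m t p.1) - T m t p.1)‖ ≤ n * ‖p‖

theorem GraphBound.mono {m : Fin d} {n n' t : ℝ} (h : GraphBound T m n t) (hn : n ≤ n') :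
    GraphBound T m n' t := fun p hp k s hs =>
  (h p hp k s hs).trans (mul_le_mul_of_nonneg_right hn (norm_nonneg _))

/-- Invariance of `H¹` makes the difference quotients converge, and their bound passes to the limit.
The `1` in the maximum covers the component in `H`, where `T m t` is a contraction. -/
theorem GraphBound.exists_mem (hT : Admissible T) {m : Fin d} {n t : ℝ} (ht : 0 ≤ t)
    (h : GraphBound T m n t) {p : H × (Fin d → H)} (hp : p ∈ graphSpace T) :
    ∃ q ∈ graphSpace T, q.1 = T m t p.1 ∧ ‖q‖ ≤ max n 1 * ‖p‖ := by
  obtain ⟨q, hq, hqp⟩ := exists_mem_graphSpace (hT.invariant m t ht _ (fst_mem_sobolev_one hp))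
  refine ⟨q, hq, hqp, ?_⟩
  have h0 : 0 ≤ max n 1 * ‖p‖ := mul_nonneg (zero_le_one.trans (le_max_right _ _)) (norm_nonneg _)
  rw [Prod.norm_def]
  refine max_le ?_ ((pi_norm_le_iff_of_nonneg h0).2 fun k => ?_)
  · rw [hqp]
    refine ((hT.semigroup m).norm_apply_le ht _).trans ((norm_fst_le p).trans ?_)
    exact le_mul_of_one_le_left (norm_nonneg _) (le_max_right _ _)
  · have h1 : Tendsto (fun h : ℝ => ‖h⁻¹ • (T k h q.1 - q.1)‖) (𝓝[>] 0) (𝓝 ‖q.2 k‖) :=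
      Tendsto.norm (hq k)
    refine le_of_tendsto h1 ?_
    filter_upwards [self_mem_nhdsWithin] with s hs
    rw [hqp]
    exact (h p hp k s hs).trans (mul_le_mul_of_nonneg_right (le_max_left _ _) (norm_nonneg _))

theorem GraphBound.add (hT : Admissible T) {m : Fin d} {n n' s t : ℝ} (hs : 0 ≤ s) (ht : 0 ≤ t)
    (hn : 0 ≤ n) (h : GraphBound T m n s) (h' : GraphBound T m n' t) :
    GraphBound T m (n * max n' 1) (s + t) := by
  intro p hp k u hu
  obtain ⟨q, hq, hqp, hqn⟩ := h'.exists_mem hT ht hp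
  rw [(hT.semigroup m).apply_add hs ht, ← hqp]
  refine (h q hq k u hu).trans ?_
  rw [mul_assoc]
  exact mul_le_mul_of_nonneg_left hqn hn

/-- For a fixed step the quotient depends continuously on `t`, although the derivative itself need
not; this closedness is what Baire's theorem requires. -/
theorem isClosed_graphBound (hT : ∀ i, IsContractionSemigroup (T i)) (m : Fin d) (n : ℝ) :
    IsClosed {t : ℝ | GraphBound T m n (max t 0)} := by
  simp only [GraphBound, ofPred_forall]
  refine isClosed_iInter fun p => isClosed_iInter fun hp => isClosed_iInter fun k =>
    isClosed_iInter fun h => isClosed_iInter fun hh => isClosed_le ?_ continuous_const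
  have hc := (hT m).continuous_max p.1
  exact ((((T k h).continuous.comp hc).sub hc).const_smul h⁻¹).norm

variable [CompleteSpace H]

theorem isClosed_graphSpace (hT : ∀ i, IsContractionSemigroup (T i)) :
    IsClosed (graphSpace T : Set (H × (Fin d → H))) := by
  have : (graphSpace T : Set (H × (Fin d → H))) =
      ⋂ k, (fun p : H × (Fin d → H) => (p.1, p.2 k)) ⁻¹' {q | IsGeneratorValue (T k) q.1 q.2} := by
    ext p; simp [mem_graphSpace]
  rw [this]
  exact isClosed_iInter fun k => (isClosed_isGeneratorValue (hT k)).preimage (by fun_prop)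

/-- Uniform boundedness principle on the complete graph space, for the family of difference
quotients indexed by direction and step. It is pointwise bounded because `T m t` preserves `H¹`. -/
theorem exists_graphBound (hT : Admissible T) (m : Fin d) {t : ℝ} (ht : 0 ≤ t) :
    ∃ n : ℝ, GraphBound T m n t := by
  have : CompleteSpace (graphSpace T) := (isClosed_graphSpace hT.semigroup).completeSpace_coe
  let g : Fin d × {h : ℝ // 0 < h} → graphSpace T →L[ℂ] H := fun i =>
    ((i.2.1⁻¹ : ℝ) : ℂ) • ((T i.1 i.2.1 - ContinuousLinearMap.id ℂ H).comp
      ((T m t).comp ((ContinuousLinearMap.fst ℂ H (Fin d → H)).comp (graphSpace T).subtypeL)))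
  have hg : ∀ i p, g i p = i.2.1⁻¹ • (T i.1 i.2.1 (T m t p.1.1) - T m t p.1.1) := by
    intro i p
    simp only [g, smul_apply, ContinuousLinearMap.comp_apply,
      sub_apply, Complex.coe_smul]
    rfl
  obtain ⟨C, hC⟩ := banach_steinhaus (g := g) fun p => by
    choose D hD using mem_sobolev_one.1 (hT.invariant m t ht _ (fst_mem_sobolev_one p.2))
    refine ⟨∑ k, ‖D k‖, fun i => ?_⟩
    rw [hg, norm_smul, norm_inv, Real.norm_of_nonneg i.2.2.le, inv_mul_le_iff₀ i.2.2]
    exact ((hD i.1).norm_sub_le (hT.semigroup _) i.2.2.le).trans (mul_le_mul_of_nonneg_left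
      (Finset.single_le_sum (f := fun k => ‖D k‖) (fun _ _ => norm_nonneg _) (Finset.mem_univ i.1))
      i.2.2.le)
  refine ⟨C, fun p hp k h hh => ?_⟩
  have := (g (k, ⟨h, hh⟩)).le_of_opNorm_le (hC _) ⟨p, hp⟩
  rwa [hg] at this

/-- Away from `t = 0` the semigroups are locally bounded on `H¹`. -/
theorem exists_graphBound_Icc (hT : Admissible T) (m : Fin d) {θ : ℝ} (hθ : 0 < θ) (R : ℝ) :
    ∃ n : ℝ, 0 ≤ n ∧ ∀ t ∈ Icc θ R, GraphBound T m n t := by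
  -- By Baire some bound holds on an open set meeting `(0, θ)`; `a` is a point of it there.
  have hcover : ⋃ n : ℕ, {t : ℝ | GraphBound T m n (max t 0)} = univ := by
    refine eq_univ_of_forall fun t => mem_iUnion.2 ?_
    obtain ⟨n, hn⟩ := exists_graphBound hT m (le_max_right t 0)
    obtain ⟨N, hN⟩ := exists_nat_ge n
    exact ⟨N, hn.mono hN⟩
  have hdense := dense_iUnion_interior_of_closed
    (fun n : ℕ => isClosed_graphBound hT.semigroup m n) hcover
  obtain ⟨a, ha, haU⟩ := hdense.inter_open_nonempty (Ioo 0 θ) isOpen_Ioo (nonempty_Ioo.2 hθ)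
  obtain ⟨n, hn⟩ := mem_iUnion.1 haU
  refine isCompact_Icc.induction_on (p := fun S => ∃ n : ℝ, 0 ≤ n ∧ ∀ t ∈ S, GraphBound T m n t)
    ⟨0, le_rfl, by simp⟩ (fun s t hst ⟨n, h0, h⟩ => ⟨n, h0, fun x hx => h x (hst hx)⟩)
    (fun s t ⟨n, h0, h⟩ ⟨n', _, h'⟩ => ⟨max n n', h0.trans (le_max_left _ _), fun x hx =>
      hx.elim (fun hx => (h x hx).mono (le_max_left _ _))
        fun hx => (h' x hx).mono (le_max_right _ _)⟩) fun t ht => ?_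
  -- A time `x` near `t` is a time near `a` plus the fixed time `t - a`, so the bound near `a` is
  -- transported by `GraphBound.add`.
  have hy : 0 ≤ t - a := by linarith [ht.1, ha.2]
  obtain ⟨n', hn'⟩ := exists_graphBound hT m hy
  have hmem : interior {t : ℝ | GraphBound T m n (max t 0)} ∩ Ioi 0 ∈ 𝓝 (t - (t - a)) := by
    rw [sub_sub_cancel]
    exact inter_mem (isOpen_interior.mem_nhds hn) (Ioi_mem_nhds ha.1)
  have hpre : (fun x => x - (t - a)) ⁻¹' (interior {t : ℝ | GraphBound T m n (max t 0)} ∩ Ioi 0)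
      ∈ 𝓝 t := (continuous_id.sub continuous_const).continuousAt.preimage_mem_nhds hmem
  refine ⟨_, mem_nhdsWithin_of_mem_nhds hpre, n * max n' 1, by positivity, fun x hx => ?_⟩
  have hx0 : 0 < x - (t - a) := hx.2
  have hx1 : GraphBound T m n (max (x - (t - a)) 0) := interior_subset hx.1
  rw [max_eq_left hx0.le] at hx1
  have := hx1.add hT hx0.le hy n.cast_nonneg hn'
  rwa [sub_add_cancel] at this

end GraphSpace

/-! ### The orbit `Tf` and its partial derivatives -/

section Orbit

variable {H : Type*} [NormedAddCommGroup H] [InnerProductSpace ℂ H] {d : ℕ}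
  {T : Fin d → ℝ → H →L[ℂ] H}

/-- The product of the operators `T_j(t_j)` along a list of indices. -/
def orbitList (T : Fin d → ℝ → H →L[ℂ] H) (l : List (Fin d)) (t : Fin d → ℝ) (f : H) : H :=
  l.foldr (fun j g => T j (t j) g) f

@[simp] theorem orbitList_nil (t : Fin d → ℝ) (f : H) : orbitList T [] t f = f := rfl

@[simp] theorem orbitList_cons (j : Fin d) (l : List (Fin d)) (t : Fin d → ℝ) (f : H) :
    orbitList T (j :: l) t f = T j (t j) (orbitList T l t f) := rfl

theorem orbitList_append (l₁ l₂ : List (Fin d)) (t : Fin d → ℝ) (f : H) :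
    orbitList T (l₁ ++ l₂) t f = orbitList T l₁ t (orbitList T l₂ t f) := by
  simp [orbitList]

theorem orbit_eq_orbitList (t : Fin d → ℝ) (f : H) :
    orbit T f t = orbitList T (List.finRange d) t f := rfl

theorem orbitList_congr {l : List (Fin d)} {t t' : Fin d → ℝ} (h : ∀ j ∈ l, t j = t' j) (f : H) :
    orbitList T l t f = orbitList T l t' f := by
  induction l with
  | nil => rfl
  | cons j l ih =>
    simp only [List.mem_cons, forall_eq_or_imp] at h
    rw [orbitList_cons, orbitList_cons, ih h.2, h.1]

theorem orbitList_sub (l : List (Fin d)) (t : Fin d → ℝ) (f g : H) :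
    orbitList T l t (f - g) = orbitList T l t f - orbitList T l t g := by
  induction l with
  | nil => rfl
  | cons j l ih => simp [ih]

theorem orbitList_smul (l : List (Fin d)) (t : Fin d → ℝ) (c : ℝ) (f : H) :
    orbitList T l t (c • f) = c • orbitList T l t f := by
  induction l with
  | nil => rfl
  | cons j l ih =>
    rw [orbitList_cons, ih, ← Complex.coe_smul, map_smul, Complex.coe_smul, orbitList_cons]

theorem norm_orbitList_le (hT : ∀ i, IsContractionSemigroup (T i)) (l : List (Fin d))
    {t : Fin d → ℝ} (ht : ∀ j, 0 ≤ t j) (f : H) : ‖orbitList T l t f‖ ≤ ‖f‖ := by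
  induction l with
  | nil => rfl
  | cons j l ih => exact ((hT j).norm_apply_le (ht j) _).trans ih

theorem continuousOn_orbitList (hT : ∀ i, IsContractionSemigroup (T i)) (l : List (Fin d))
    {X : Type*} [TopologicalSpace X] {S : Set X} {u : X → Fin d → ℝ} {g : X → H}
    (hu : ContinuousOn u S) (hg : ContinuousOn g S) (h0 : ∀ x ∈ S, ∀ j, 0 ≤ u x j) :
    ContinuousOn (fun x => orbitList T l (u x) (g x)) S := by
  induction l with
  | nil => exact hg
  | cons j l ih =>
    exact (hT j).continuousOn_apply ((continuous_apply j).comp_continuousOn hu) ih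
      fun x hx => h0 x hx j

theorem orbitList_mem_sobolev_one (hT : Admissible T) (l : List (Fin d)) {t : Fin d → ℝ}
    (ht : ∀ j, 0 ≤ t j) {f : H} (hf : f ∈ sobolev T 1) : orbitList T l t f ∈ sobolev T 1 := by
  induction l with
  | nil => exact hf
  | cons j l ih => exact hT.invariant j _ (ht j) _ ih

/-- The index `k` occurs exactly once in `List.finRange d`, so only one factor of the product
depends on the `k`-th time. -/
theorem exists_orbit_split (T : Fin d → ℝ → H →L[ℂ] H) (k : Fin d) : ∃ l₁ l₂ : List (Fin d),
    ∀ (f : H) (t : Fin d → ℝ) (x : ℝ), orbit T f (Function.update t k x) =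
      orbitList T l₁ t (T k x (orbitList T l₂ t f)) := by
  obtain ⟨l₁, l₂, hl⟩ := List.append_of_mem (List.mem_finRange k)
  have hnd := List.nodup_finRange d
  rw [hl, List.nodup_append, List.nodup_cons] at hnd
  refine ⟨l₁, l₂, fun f t x => ?_⟩
  rw [orbit_eq_orbitList, hl, orbitList_append, orbitList_cons, Function.update_self,
    orbitList_congr (l := l₁) (t' := t), orbitList_congr (l := l₂) (t' := t)]
  · exact fun j hj => Function.update_of_ne (by rintro rfl; exact hnd.2.1.1 hj) _ _
  · exact fun j hj => Function.update_of_ne (hnd.2.2 j hj k (by simp)) _ _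

theorem continuousOn_orbit (hT : ∀ i, IsContractionSemigroup (T i)) (f : H) :
    ContinuousOn (orbit T f) {t | ∀ j, 0 ≤ t j} :=
  continuousOn_orbitList hT (List.finRange d) continuousOn_id continuousOn_const fun _ h => h

variable [CompleteSpace H]

/-- The local bounds on `H¹` multiply along the product; all times must stay away from `0`, where no
bound is available. -/
theorem exists_orbitList_bound (hT : Admissible T) (l : List (Fin d)) {θ : ℝ} (hθ : 0 < θ) (R : ℝ)
    {p : H × (Fin d → H)} (hp : p ∈ graphSpace T) :
    ∃ C : ℝ, ∀ t : Fin d → ℝ, (∀ j, t j ∈ Icc θ R) →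
      ∃ q ∈ graphSpace T, q.1 = orbitList T l t p.1 ∧ ‖q‖ ≤ C := by
  induction l with
  | nil => exact ⟨‖p‖, fun t _ => ⟨p, hp, rfl, le_rfl⟩⟩
  | cons j l ih =>
    obtain ⟨C, hC⟩ := ih
    obtain ⟨n, hn, hb⟩ := exists_graphBound_Icc hT j hθ R
    refine ⟨max n 1 * C, fun t ht => ?_⟩
    obtain ⟨q, hq, hqp, hqC⟩ := hC t ht
    obtain ⟨q', hq', hqp', hqC'⟩ := (hb _ (ht j)).exists_mem hT (hθ.le.trans (ht j).1) hq
    refine ⟨q', hq', by rw [hqp', hqp, orbitList_cons], hqC'.trans ?_⟩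
    exact mul_le_mul_of_nonneg_left hqC (zero_le_one.trans (le_max_right _ _))

/-- Differentiability of the orbit of a vector of `H¹` in one variable. -/
theorem hasDerivWithinAt_orbit_of_split (hT : ∀ i, IsContractionSemigroup (T i)) {k : Fin d}
    {l₁ l₂ : List (Fin d)} (hl : ∀ (f : H) (t : Fin d → ℝ) (x : ℝ),
      orbit T f (Function.update t k x) = orbitList T l₁ t (T k x (orbitList T l₂ t f)))
    {f g : H} {t : Fin d → ℝ} (ht : ∀ j, 0 ≤ t j)
    (hg : IsGeneratorValue (T k) (orbitList T l₂ t f) g) {x : ℝ} (hx : 0 ≤ x) :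
    HasDerivWithinAt (fun x => orbit T f (Function.update t k x))
      (orbitList T l₁ t (T k x g)) (Ici 0) x := by
  have h1 := hg.hasDerivWithinAt (hT k) hx
  simp only [hl]
  rw [hasDerivWithinAt_iff_tendsto] at h1 ⊢
  -- The factors to the left of `T k` form a fixed linear contraction, so they do not increase the
  -- remainder.
  refine squeeze_zero_norm (fun y => ?_) h1
  rw [← orbitList_sub, ← orbitList_smul, ← orbitList_sub, Real.norm_of_nonneg (by positivity)]
  exact mul_le_mul_of_nonneg_left (norm_orbitList_le hT _ ht _) (by positivity)

theorem orbitPartial_eq_of_split (hT : ∀ i, IsContractionSemigroup (T i)) {k : Fin d}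
    {l₁ l₂ : List (Fin d)} (hl : ∀ (f : H) (t : Fin d → ℝ) (x : ℝ),
      orbit T f (Function.update t k x) = orbitList T l₁ t (T k x (orbitList T l₂ t f)))
    {f g : H} {t : Fin d → ℝ} (ht : ∀ j, 0 ≤ t j)
    (hg : IsGeneratorValue (T k) (orbitList T l₂ t f) g) {x : ℝ} (hx : 0 ≤ x) :
    orbitPartial T f k (Function.update t k x) = orbitList T l₁ t (T k x g) := by
  have h := hasDerivWithinAt_orbit_of_split hT hl ht hg hx
  unfold orbitPartial
  simp only [Function.update_idem, Function.update_self]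
  exact h.derivWithin (uniqueDiffOn_Ici 0 x hx)

theorem hasDerivWithinAt_orbit (hT : Admissible T) {f : H} (hf : f ∈ sobolev T 1) (k : Fin d)
    {t : Fin d → ℝ} (ht : ∀ j, 0 ≤ t j) {x : ℝ} (hx : 0 ≤ x) :
    HasDerivWithinAt (fun x => orbit T f (Function.update t k x))
      (orbitPartial T f k (Function.update t k x)) (Ici 0) x := by
  obtain ⟨l₁, l₂, hl⟩ := exists_orbit_split T k
  obtain ⟨g, hg⟩ := mem_sobolev_one.1 (orbitList_mem_sobolev_one hT l₂ ht hf) k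
  rw [orbitPartial_eq_of_split hT.semigroup hl ht hg hx]
  exact hasDerivWithinAt_orbit_of_split hT.semigroup hl ht hg hx

/-- The partial derivatives of the orbit of a vector of `H¹` are bounded on compact subsets of
the open orthant. -/
theorem exists_orbitPartial_bound (hT : Admissible T) {f : H} (hf : f ∈ sobolev T 1) (k : Fin d)
    {θ : ℝ} (hθ : 0 < θ) (R : ℝ) :
    ∃ C : ℝ, ∀ t : Fin d → ℝ, (∀ j, t j ∈ Icc θ R) → ‖orbitPartial T f k t‖ ≤ C := by
  obtain ⟨l₁, l₂, hl⟩ := exists_orbit_split T k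
  obtain ⟨p, hp, rfl⟩ := exists_mem_graphSpace hf
  obtain ⟨C, hC⟩ := exists_orbitList_bound hT l₂ hθ R hp
  refine ⟨C, fun t ht => ?_⟩
  have ht0 : ∀ j, 0 ≤ t j := fun j => hθ.le.trans (ht j).1
  obtain ⟨q, hq, hqp, hqC⟩ := hC t ht
  have h := orbitPartial_eq_of_split hT.semigroup hl ht0 (hqp ▸ hq k) (ht0 k)
  rw [Function.update_eq_self] at h
  rw [h]
  exact (norm_orbitList_le hT.semigroup _ ht0 _).trans
    (((hT.semigroup k).norm_apply_le (ht0 k) _).trans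
      ((norm_le_pi_norm q.2 k).trans ((norm_snd_le q).trans hqC)))

end Orbit

/-! ### Products of probability measures -/

section ProductMeasure

/-- Replacing one coordinate by an independent copy preserves a product of probability measures. -/
theorem measurePreserving_update {ι : Type*} [Fintype ι] [DecidableEq ι] {α : ι → Type*}
    [∀ i, MeasurableSpace (α i)] (ν : ∀ i, Measure (α i)) [∀ i, IsProbabilityMeasure (ν i)]
    (k : ι) :
    MeasurePreserving (fun q : (∀ i, α i) × α k => Function.update q.1 k q.2)
      ((Measure.pi ν).prod (ν k)) (Measure.pi ν) := by
  have hm : Measurable fun q : (∀ i, α i) × α k => Function.update q.1 k q.2 := by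
    refine measurable_pi_lambda _ fun i => ?_
    rcases eq_or_ne i k with rfl | h
    · simpa using measurable_snd
    · simpa [Function.update_of_ne h, Function.comp_def] using
        (measurable_pi_apply i).comp (measurable_fst (α := ∀ i, α i) (β := α k))
  refine ⟨hm, (Measure.pi_eq fun s hs => ?_).symm⟩
  have hpre : (fun q : (∀ i, α i) × α k => Function.update q.1 k q.2) ⁻¹' (univ.pi s) =
      (univ.pi (Function.update s k univ)) ×ˢ (s k) := by
    ext q
    simp only [mem_preimage, mem_univ_pi, mem_prod]
    constructor
    · refine fun h => ⟨fun i => ?_, by simpa using h k⟩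
      rcases eq_or_ne i k with rfl | hi
      · simp
      · simpa [Function.update_of_ne hi] using h i
    · rintro ⟨h, hk⟩ i
      rcases eq_or_ne i k with rfl | hi
      · simpa using hk
      · simpa [Function.update_of_ne hi] using h i
  rw [Measure.map_apply hm (MeasurableSet.univ_pi hs), hpre, Measure.prod_prod, Measure.pi_pi,
    ← Finset.prod_erase_mul _ _ (Finset.mem_univ k),
    ← Finset.prod_erase_mul Finset.univ (fun i => ν i (s i)) (Finset.mem_univ k)]
  simp only [Function.update_self, measure_univ, mul_one]
  congr 1
  refine Finset.prod_congr rfl fun i hi => ?_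
  rw [Function.update_of_ne (Finset.ne_of_mem_erase hi)]

theorem integrable_comp_update {ι : Type*} [Fintype ι] [DecidableEq ι] {α : ι → Type*}
    [∀ i, MeasurableSpace (α i)] (ν : ∀ i, Measure (α i)) [∀ i, IsProbabilityMeasure (ν i)]
    (k : ι) {E : Type*} [NormedAddCommGroup E] {g : (∀ i, α i) → E}
    (hg : Integrable g (Measure.pi ν)) :
    Integrable (fun q : (∀ i, α i) × α k => g (Function.update q.1 k q.2))
      ((Measure.pi ν).prod (ν k)) :=
  (measurePreserving_update ν k).integrable_comp_of_integrable hg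

theorem integral_pi_update {ι : Type*} [Fintype ι] [DecidableEq ι] {α : ι → Type*}
    [∀ i, MeasurableSpace (α i)] (ν : ∀ i, Measure (α i)) [∀ i, IsProbabilityMeasure (ν i)]
    (k : ι) {E : Type*} [NormedAddCommGroup E] [NormedSpace ℝ E] {g : (∀ i, α i) → E}
    (hg : Integrable g (Measure.pi ν)) :
    ∫ x, g x ∂(Measure.pi ν) =
      ∫ x, ∫ y, g (Function.update x k y) ∂(ν k) ∂(Measure.pi ν) := by
  have h := measurePreserving_update ν k
  rw [integral_integral (integrable_comp_update ν k hg), ← integral_map h.measurable.aemeasurable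
    (by rw [h.map_eq]; exact hg.aestronglyMeasurable), h.map_eq]

theorem measurePreserving_uncurry {ι κ : Type*} [Fintype ι] [Fintype κ] {α : Type*}
    [MeasurableSpace α] (ν : Measure α) [IsProbabilityMeasure ν] :
    MeasurePreserving (fun (x : ι → κ → α) (p : ι × κ) => x p.1 p.2)
      (Measure.pi fun _ : ι => Measure.pi fun _ : κ => ν) (Measure.pi fun _ : ι × κ => ν) := by
  have hm : Measurable fun (x : ι → κ → α) (p : ι × κ) => x p.1 p.2 := by fun_prop
  refine ⟨hm, (Measure.pi_eq fun s hs => ?_).symm⟩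
  have hpre : (fun (x : ι → κ → α) (p : ι × κ) => x p.1 p.2) ⁻¹' (univ.pi s) =
      univ.pi fun i => univ.pi fun j => s (i, j) := by
    ext x; simp
  rw [Measure.map_apply hm (MeasurableSet.univ_pi hs), hpre, Measure.pi_pi, Fintype.prod_prod_type]
  simp [Measure.pi_pi]

end ProductMeasure

/-! ### Integrals over cubes, parametrised by the unit cube -/

section Cube

variable {E : Type*} [NormedAddCommGroup E] [NormedSpace ℝ E]

theorem integral_unitInterval (g : ℝ → E) :
    ∫ y : unitInterval, g y = ∫ y in (0 : ℝ)..1, g y := by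
  rw [integral_subtype measurableSet_Icc, intervalIntegral.integral_of_le zero_le_one,
    integral_Icc_eq_integral_Ioc]

omit [NormedSpace ℝ E] in
theorem intervalIntegrable_of_unitInterval {g : ℝ → E}
    (h : Integrable fun y : unitInterval => g y) : IntervalIntegrable g volume 0 1 := by
  rw [intervalIntegrable_iff_integrableOn_Icc_of_le zero_le_one]
  exact (unitInterval.measurePreserving_coe.integrable_comp_emb
    unitInterval.measurableEmbedding_coe).1 h

open scoped Pointwise in
theorem setIntegral_pi_Icc {J : Type*} [Fintype J] {σ : ℝ} (hσ : 0 < σ) (g : (J → ℝ) → E) :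
    ∫ τ in univ.pi (fun _ : J => Icc (0 : ℝ) σ), g τ =
      σ ^ Fintype.card J • ∫ x : J → unitInterval, g fun i => σ * x i := by
  have hset : univ.pi (fun _ : J => Icc (0 : ℝ) σ) = σ • univ.pi (fun _ : J => Icc (0 : ℝ) 1) := by
    ext τ
    rw [mem_smul_set_iff_inv_smul_mem₀ hσ.ne']
    simp only [mem_univ_pi, mem_Icc, Pi.smul_apply, smul_eq_mul]
    refine forall_congr' fun i => ?_
    rw [inv_mul_le_iff₀ hσ, mul_one, mul_nonneg_iff_of_pos_left (inv_pos.2 hσ)]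
  have h1 := Measure.setIntegral_comp_smul_of_pos (volume : Measure (J → ℝ)) g
    (univ.pi fun _ : J => Icc (0 : ℝ) 1) hσ
  rw [← hset, Module.finrank_fintype_fun_eq_card] at h1
  have h2 : MeasurePreserving (fun (x : J → unitInterval) i => (x i : ℝ)) volume
      (volume.restrict (univ.pi fun _ : J => Icc (0 : ℝ) 1)) := by
    rw [volume_pi, volume_pi, Measure.restrict_pi_pi]
    exact measurePreserving_pi _ _ fun _ => unitInterval.measurePreserving_coe
  have hemb : MeasurableEmbedding fun (x : J → unitInterval) i => (x i : ℝ) := by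
    refine Topology.IsClosedEmbedding.measurableEmbedding ?_
    refine Continuous.isClosedEmbedding (by fun_prop) fun x y h => ?_
    funext i
    exact Subtype.ext (congrFun h i)
  have h3 := h2.integral_comp hemb fun x : J → ℝ => g (σ • x)
  have h4 : ∀ x : J → unitInterval, (σ • fun i => (x i : ℝ)) = fun i => σ * x i := fun x => rfl
  simp only [h4] at h3
  rw [h3, h1, smul_inv_smul₀ (by positivity)]

variable {ι : Type*} [Fintype ι] [DecidableEq ι]

/-- The point of the cube `[σθ, σ]^ι` with the coordinates in `M` replaced by `0`, parametrised by
the unit cube. -/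
def cubePoint (M : Finset ι) (θ σ : ℝ) (x : ι → unitInterval) : ι → ℝ :=
  fun i => if i ∈ M then 0 else σ * ((1 - θ) * x i + θ)

omit [Fintype ι] in
theorem continuous_cubePoint (M : Finset ι) (σ : ℝ) :
    Continuous fun q : unitInterval × (ι → unitInterval) => cubePoint M q.1 σ q.2 := by
  refine continuous_pi fun i => ?_
  unfold cubePoint
  split_ifs <;> fun_prop

omit [Fintype ι] in
theorem cubePoint_update {M : Finset ι} {k : ι} (hk : k ∉ M) (θ σ : ℝ) (x : ι → unitInterval)
    (y : unitInterval) : cubePoint M θ σ (Function.update x k y) =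
      Function.update (cubePoint M θ σ x) k (σ * ((1 - θ) * y + θ)) := by
  funext i
  rcases eq_or_ne i k with rfl | hi
  · simp [cubePoint, hk]
  · simp [cubePoint, Function.update_of_ne hi]

omit [Fintype ι] in
theorem cubePoint_insert (M : Finset ι) (k : ι) (σ : ℝ) (x : ι → unitInterval) :
    cubePoint (insert k M) 0 σ x = Function.update (cubePoint M 0 σ x) k 0 := by
  funext i
  rcases eq_or_ne i k with rfl | hi
  · simp [cubePoint]
  · simp [cubePoint, hi]

omit [Fintype ι] in
theorem cubePoint_mem {M : Finset ι} {θ σ : ℝ} (hθ : θ ∈ Icc (0 : ℝ) 1) (hσ : 0 ≤ σ)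
    (x : ι → unitInterval) (i : ι) : cubePoint M θ σ x i ∈ Icc 0 σ := by
  have h0 := (x i).2.1
  have h1 := (x i).2.2
  unfold cubePoint
  split_ifs
  · exact ⟨le_rfl, hσ⟩
  · refine ⟨mul_nonneg hσ (add_nonneg (mul_nonneg (by linarith [hθ.2]) h0) hθ.1), ?_⟩
    refine mul_le_of_le_one_right hσ ?_
    nlinarith [hθ.2]

omit [Fintype ι] in
theorem le_cubePoint {M : Finset ι} {θ σ : ℝ} (hθ : θ ≤ 1) (hσ : 0 ≤ σ)
    (x : ι → unitInterval) {i : ι} (hi : i ∉ M) : σ * θ ≤ cubePoint M θ σ x i := by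
  have h0 := (x i).2.1
  simp only [cubePoint, hi, if_false]
  refine mul_le_mul_of_nonneg_left ?_ hσ
  have := mul_nonneg (sub_nonneg.2 hθ) h0
  linarith

/-- The frozen coordinates become dummy variables of total mass one. All integrals then live on one
probability space, whatever is frozen. -/
theorem setIntegral_extend (M : Finset ι) {σ : ℝ} (hσ : 0 < σ) {g : (ι → ℝ) → E}
    (hg : ContinuousOn g {τ | ∀ i, τ i ∈ Icc 0 σ}) :
    ∫ τ in univ.pi (fun _ : {i // i ∉ M} => Icc (0 : ℝ) σ),
      g (fun i => if h : i ∉ M then τ ⟨i, h⟩ else 0) =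
      σ ^ (Fintype.card ι - M.card) • ∫ x : ι → unitInterval, g (cubePoint M 0 σ x) := by
  rw [setIntegral_pi_Icc hσ]
  have hcard : Fintype.card {i // i ∉ M} = Fintype.card ι - M.card := by
    rw [Fintype.card_subtype_compl]; simp
  rw [hcard]
  congr 1
  have h1 := measurePreserving_piEquivPiSubtypeProd
    (fun _ : ι => (volume : Measure unitInterval)) (· ∉ M)
  have h2 := measurePreserving_fst.comp h1
  have hfun : ∀ x : ι → unitInterval, cubePoint M 0 σ x = fun i => if h : i ∉ M then
      σ * ((Prod.fst ∘ MeasurableEquiv.piEquivPiSubtypeProd (fun _ : ι => unitInterval) (· ∉ M)) x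
        ⟨i, h⟩ : ℝ) else 0 := by
    intro x
    funext i
    by_cases h : i ∈ M <;> simp [cubePoint, h, MeasurableEquiv.piEquivPiSubtypeProd]
  simp only [hfun]
  rw [volume_pi, volume_pi, ← h2.map_eq, integral_map h2.measurable.aemeasurable]
  refine (Continuous.stronglyMeasurable ?_).aestronglyMeasurable
  refine hg.comp_continuous ?_ fun y i => ?_
  · refine continuous_pi fun i => ?_
    split_ifs <;> fun_prop
  · split_ifs with h
    · exact ⟨le_rfl, hσ.le⟩
    · exact ⟨mul_nonneg hσ.le (y _).2.1, mul_le_of_le_one_right hσ.le (y _).2.2⟩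

/-- The fundamental theorem of calculus in one of the variables, integrated over the others. -/
theorem integral_cubePoint_of_hasDerivAt [CompleteSpace E] {M : Finset ι} {k : ι} (hk : k ∉ M)
    {θ σ : ℝ} (hθ : θ < 1) (hσ : 0 < σ) {P Q : (ι → ℝ) → E}
    (hPQ : ∀ x : ι → unitInterval, HasDerivAt (fun y => P (Function.update (cubePoint M θ σ x) k y))
      (Q (cubePoint M θ σ x)) (cubePoint M θ σ x k))
    (hQ : Integrable fun x => Q (cubePoint M θ σ x)) :
    ∫ x, Q (cubePoint M θ σ x) = (σ * (1 - θ))⁻¹ •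
      ∫ x : ι → unitInterval, (P (Function.update (cubePoint M θ σ x) k σ) -
        P (Function.update (cubePoint M θ σ x) k (σ * θ))) := by
  have hc : σ * (1 - θ) ≠ 0 := (mul_pos hσ (sub_pos.2 hθ)).ne'
  have hQ' : Integrable (fun x => Q (cubePoint M θ σ x))
      (Measure.pi fun _ : ι => (volume : Measure unitInterval)) := hQ
  -- Resampling the `k`-th coordinate isolates a one-dimensional integral on almost every line
  -- parallel to that axis.
  rw [volume_pi, integral_pi_update _ k hQ', ← integral_smul]
  refine integral_congr_ae ?_
  filter_upwards [(integrable_comp_update _ k hQ').prod_right_ae] with x hx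
  simp only [cubePoint_update hk] at hx ⊢
  set τ := cubePoint M θ σ x
  have hd : ∀ y ∈ Icc (0 : ℝ) 1,
      HasDerivAt (fun y => P (Function.update τ k (σ * ((1 - θ) * y + θ))))
        ((σ * (1 - θ)) • Q (Function.update τ k (σ * ((1 - θ) * y + θ)))) y := by
    intro y hy
    have h1 := hPQ (Function.update x k ⟨y, hy⟩)
    simp only [cubePoint_update hk, Function.update_idem, Function.update_self] at h1
    have h2 : HasDerivAt (fun y : ℝ => σ * ((1 - θ) * y + θ)) (σ * (1 - θ)) y := by
      simpa using (((hasDerivAt_id y).const_mul (1 - θ)).add_const θ).const_mul σ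
    exact h1.scomp y h2
  have hint := intervalIntegrable_of_unitInterval
    (g := fun y => Q (Function.update τ k (σ * ((1 - θ) * y + θ)))) hx
  have key := intervalIntegral.integral_eq_sub_of_hasDerivAt_of_le zero_le_one
    (fun y hy => (hd y hy).continuousAt.continuousWithinAt)
    (fun y hy => hd y (Ioo_subset_Icc_self hy)) (hint.smul (σ * (1 - θ)))
  rw [integral_unitInterval fun y => Q (Function.update τ k (σ * ((1 - θ) * y + θ)))]
  rw [intervalIntegral.integral_smul] at key
  rw [← inv_smul_smul₀ hc (∫ y in (0 : ℝ)..1, _), key]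
  simp

/-- The derivative is a pointwise limit of continuous difference quotients; it is not assumed to be
continuous. -/
theorem stronglyMeasurable_of_hasDerivAt {M : Finset ι} {k : ι} {θ σ : ℝ} (hθ : θ ∈ Icc (0 : ℝ) 1)
    (hσ : 0 ≤ σ) {P Q : (ι → ℝ) → E} (hP : ContinuousOn P {τ | ∀ i, 0 ≤ τ i})
    (hPQ : ∀ x : ι → unitInterval, HasDerivAt (fun y => P (Function.update (cubePoint M θ σ x) k y))
      (Q (cubePoint M θ σ x)) (cubePoint M θ σ x k)) :
    StronglyMeasurable fun x => Q (cubePoint M θ σ x) := by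
  have hcp : Continuous fun x : ι → unitInterval => cubePoint M θ σ x :=
    (continuous_cubePoint M σ).comp (Continuous.prodMk_right (⟨θ, hθ⟩ : unitInterval))
  let u : ℕ → ℝ := fun n => 1 / ((n : ℝ) + 1)
  have hu0 : ∀ n, 0 < u n := fun n => Nat.one_div_pos_of_nat
  have hu : Tendsto u atTop (𝓝[≠] 0) := tendsto_nhdsWithin_iff.2
    ⟨tendsto_one_div_add_atTop_nhds_zero_nat, Eventually.of_forall fun n => (hu0 n).ne'⟩
  refine stronglyMeasurable_of_tendsto atTop (f := fun n x => (u n)⁻¹ •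
    (P (Function.update (cubePoint M θ σ x) k (cubePoint M θ σ x k + u n)) -
      P (cubePoint M θ σ x))) (fun n => Continuous.stronglyMeasurable ?_) ?_
  · refine Continuous.const_smul (Continuous.sub ?_ ?_) _
    · refine hP.comp_continuous (hcp.update k (by fun_prop)) fun x i => ?_
      rcases eq_or_ne i k with rfl | hi
      · simpa using add_nonneg (cubePoint_mem hθ hσ x i).1 (hu0 n).le
      · simpa [Function.update_of_ne hi] using (cubePoint_mem hθ hσ x i).1
    · exact hP.comp_continuous hcp fun x i => (cubePoint_mem hθ hσ x i).1
  · refine tendsto_pi_nhds.2 fun x => ?_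
    have h := (hasDerivAt_iff_tendsto_slope_zero.1 (hPQ x)).comp hu
    refine h.congr fun n => ?_
    simp

omit [DecidableEq ι] in
/-- Parametric integrals of continuous functions over the unit cube are continuous. -/
theorem continuous_integral_cube {f : unitInterval × (ι → unitInterval) → E} (hf : Continuous f) :
    Continuous fun θ => ∫ x, f (θ, x) := by
  have := continuous_parametric_integral_of_continuous (μ := (volume : Measure (ι → unitInterval)))
    (f := fun θ x => f (θ, x)) (by exact hf) isCompact_univ
  simpa using this

omit [NormedSpace ℝ E] [DecidableEq ι] in
theorem integrable_cube {f : (ι → unitInterval) → E} (hf : Continuous f) : Integrable f :=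
  hf.integrable_of_hasCompactSupport (HasCompactSupport.of_compactSpace f)

end Cube

/-! ### Coefficients with derivatives of order `s^n` -/

section Symbols

variable {ι : Type*} [Fintype ι]

/-- Families of smooth functions on `ℝ^ι`, all of whose derivatives are `O(s^n)` uniformly for
`0 < s ≤ s₀`. -/
def IsSymbol (s₀ : ℝ) (n : ℕ) (μ : ℝ → (ι → ℝ) → ℂ) : Prop :=
  (∀ s, 0 < s → s ≤ s₀ → ContDiff ℝ ∞ (μ s)) ∧
    ∀ p : ℕ, ∃ c : ℝ, ∀ s, 0 < s → s ≤ s₀ → ∀ τ, ‖iteratedFDeriv ℝ p (μ s) τ‖ ≤ c * s ^ n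

variable {s₀ : ℝ} {n n' : ℕ} {μ μ' : ℝ → (ι → ℝ) → ℂ}

theorem IsSymbol.neg (h : IsSymbol s₀ n μ) : IsSymbol s₀ n fun s τ => -μ s τ := by
  refine ⟨fun s hs hs' => (h.1 s hs hs').neg, fun p => ?_⟩
  obtain ⟨c, hc⟩ := h.2 p
  refine ⟨c, fun s hs hs' τ => ?_⟩
  change ‖iteratedFDeriv ℝ p (-μ s) τ‖ ≤ c * s ^ n
  rw [iteratedFDeriv_neg_apply, norm_neg]
  exact hc s hs hs' τ

theorem IsSymbol.mul (h : IsSymbol s₀ n μ) (h' : IsSymbol s₀ n' μ') :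
    IsSymbol s₀ (n + n') fun s τ => μ s τ * μ' s τ := by
  refine ⟨fun s hs hs' => (h.1 s hs hs').mul (h'.1 s hs hs'), fun p => ?_⟩
  choose c hc using h.2
  choose c' hc' using h'.2
  refine ⟨∑ i ∈ Finset.range (p + 1), (p.choose i : ℝ) * c i * c' (p - i), fun s hs hs' τ => ?_⟩
  refine (norm_iteratedFDeriv_mul_le (h.1 s hs hs') (h'.1 s hs hs') τ
    (by exact_mod_cast le_top)).trans ?_
  rw [Finset.sum_mul]
  refine Finset.sum_le_sum fun i _ => ?_
  have h1 := hc i s hs hs' τ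
  have h2 := hc' (p - i) s hs hs' τ
  calc _ ≤ (p.choose i : ℝ) * (c i * s ^ n) * (c' (p - i) * s ^ n') := by
        refine mul_le_mul (mul_le_mul_of_nonneg_left h1 (by positivity)) h2 (norm_nonneg _) ?_
        exact mul_nonneg (by positivity) ((norm_nonneg _).trans h1)
    _ = _ := by rw [pow_add]; ring

theorem isSymbol_of_hasCompactSupport {d : ℕ} {g : (Fin d → ℝ) → ℂ} (hg : ContDiff ℝ ∞ g)
    (hc : HasCompactSupport g) (A : (ι → ℝ) →L[ℝ] (Fin d → ℝ)) :
    IsSymbol s₀ 0 fun _ τ => g (A τ) := by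
  refine ⟨fun s _ _ => hg.comp A.contDiff, fun p => ?_⟩
  obtain ⟨C, hC⟩ := (hc.iteratedFDeriv (𝕜 := ℝ) p).exists_bound_of_continuous
    (hg.continuous_iteratedFDeriv (by exact_mod_cast le_top))
  refine ⟨C * ‖A‖ ^ p, fun s _ _ τ => ?_⟩
  have h1 := A.iteratedFDeriv_comp_right hg τ (i := p) (by exact_mod_cast le_top)
  have h2 : (fun τ => g (A τ)) = g ∘ A := rfl
  rw [h2, h1, pow_zero, mul_one]
  refine (ContinuousMultilinearMap.norm_compContinuousLinearMap_le _ _).trans ?_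
  simp only [Finset.prod_const, Finset.card_univ, Fintype.card_fin]
  exact mul_le_mul_of_nonneg_right (hC _) (by positivity)

theorem isSymbol_const (a : ℂ) : IsSymbol s₀ 0 (fun _ (_ : ι → ℝ) => a) := by
  refine ⟨fun s _ _ => contDiff_const, fun p => ⟨‖a‖, fun s _ _ τ => ?_⟩⟩
  rcases Nat.eq_zero_or_pos p with rfl | hp
  · simp
  · rw [iteratedFDeriv_const_of_ne hp.ne']
    simp

variable [DecidableEq ι]

theorem IsSymbol.partialDeriv (h : IsSymbol s₀ n μ) (k : ι) :
    IsSymbol s₀ n fun s τ => fderiv ℝ (μ s) τ (Pi.single k 1) := by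
  refine ⟨fun s hs hs' => ((h.1 s hs hs').fderiv_right (by simp)).clm_apply contDiff_const,
    fun p => ?_⟩
  obtain ⟨c, hc⟩ := h.2 (p + 1)
  refine ⟨c, fun s hs hs' τ => ?_⟩
  refine (norm_iteratedFDeriv_clm_apply_const (N := ∞)
    ((h.1 s hs hs').fderiv_right (by simp)).contDiffAt (by exact_mod_cast le_top)).trans ?_
  rw [norm_iteratedFDeriv_fderiv]
  have : ‖(Pi.single k 1 : ι → ℝ)‖ = 1 := by rw [Pi.norm_single, norm_one]
  rw [this, one_mul]
  exact hc s hs hs' τ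

/-- The projection annihilating one coordinate. -/
def eraseCoord (k : ι) : (ι → ℝ) →L[ℝ] (ι → ℝ) :=
  ContinuousLinearMap.pi fun i => if i = k then 0 else ContinuousLinearMap.proj i

omit [Fintype ι] in
theorem eraseCoord_apply (k : ι) (τ : ι → ℝ) : eraseCoord k τ = Function.update τ k 0 := by
  funext i
  rcases eq_or_ne i k with rfl | hi
  · simp [eraseCoord]
  · simp [eraseCoord, hi]

omit [Fintype ι] in
theorem update_eq_eraseCoord (k : ι) (y : ℝ) (τ : ι → ℝ) :
    Function.update τ k y = eraseCoord k τ + Pi.single k y := by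
  rw [eraseCoord_apply]
  funext i
  rcases eq_or_ne i k with rfl | hi
  · simp
  · simp [hi]

theorem norm_eraseCoord_le (k : ι) : ‖eraseCoord k‖ ≤ 1 := by
  refine ContinuousLinearMap.opNorm_le_bound _ zero_le_one fun τ => ?_
  rw [one_mul, eraseCoord_apply]
  refine (pi_norm_le_iff_of_nonneg (norm_nonneg _)).2 fun i => ?_
  rcases eq_or_ne i k with rfl | hi
  · simp
  · simpa [hi] using norm_le_pi_norm τ i

theorem norm_iteratedFDeriv_comp_eraseCoord_le {g : (ι → ℝ) → ℂ} (hg : ContDiff ℝ ∞ g) (k : ι)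
    (p : ℕ) (τ : ι → ℝ) : ‖iteratedFDeriv ℝ p (fun τ => g (eraseCoord k τ)) τ‖ ≤
      ‖iteratedFDeriv ℝ p g (eraseCoord k τ)‖ := by
  have h1 := (eraseCoord k).iteratedFDeriv_comp_right hg τ (i := p) (by exact_mod_cast le_top)
  have h2 : (fun τ => g (eraseCoord k τ)) = g ∘ eraseCoord k := rfl
  rw [h2, h1]
  refine (ContinuousMultilinearMap.norm_compContinuousLinearMap_le _ _).trans ?_
  refine mul_le_of_le_one_right (norm_nonneg _) ?_
  exact Finset.prod_le_one (fun _ _ => norm_nonneg _) fun _ _ => norm_eraseCoord_le k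

theorem IsSymbol.shift (h : IsSymbol s₀ n μ) (k : ι) (u : ℝ → ℝ) :
    IsSymbol s₀ n fun s τ => μ s (Function.update τ k (u s)) := by
  simp only [update_eq_eraseCoord]
  have hsm : ∀ s : ℝ, 0 < s → s ≤ s₀ → ContDiff ℝ ∞ fun τ => μ s (τ + (Pi.single k (u s) : ι → ℝ)) :=
    fun s hs hs' => by exact (h.1 s hs hs').comp (contDiff_fun_id.add contDiff_const)
  refine ⟨fun s hs hs' => (hsm s hs hs').comp (eraseCoord k).contDiff, fun p => ?_⟩
  obtain ⟨c, hc⟩ := h.2 p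
  refine ⟨c, fun s hs hs' τ => ?_⟩
  refine (norm_iteratedFDeriv_comp_eraseCoord_le (hsm s hs hs') k p τ).trans ?_
  rw [iteratedFDeriv_comp_add_right]
  exact hc s hs hs' _

/-- The mean value inequality for each derivative of order `p`, with the bound of order `p + 1`,
gains the factor `|u s| ≤ s`. -/
theorem IsSymbol.diffOp (h : IsSymbol s₀ n μ) (k : ι) {u : ℝ → ℝ}
    (hu : ∀ s, 0 < s → s ≤ s₀ → |u s| ≤ s) :
    IsSymbol s₀ (n + 1) fun s => diffOp k (u s) (μ s) := by
  have hsm : ∀ s : ℝ, 0 < s → s ≤ s₀ → ContDiff ℝ ∞ fun τ => μ s (τ + Pi.single k (u s)) - μ s τ :=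
    fun s hs hs' => ((h.1 s hs hs').comp (contDiff_fun_id.add contDiff_const)).sub (h.1 s hs hs')
  have heq : ∀ s : ℝ, HardySteklov.diffOp k (u s) (μ s) = fun τ => (fun τ =>
      μ s (τ + Pi.single k (u s)) - μ s τ) (eraseCoord k τ) := by
    intro s
    funext τ
    simp only [HardySteklov.diffOp, update_eq_eraseCoord, Pi.single_zero, add_zero]
  refine ⟨fun s hs hs' => ?_, fun p => ?_⟩
  · simp only [heq]
    exact (hsm s hs hs').comp (eraseCoord k).contDiff
  obtain ⟨c, hc⟩ := h.2 (p + 1)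
  refine ⟨c, fun s hs hs' τ => ?_⟩
  simp only [heq]
  refine (norm_iteratedFDeriv_comp_eraseCoord_le (hsm s hs hs') k p τ).trans ?_
  set τ' := eraseCoord k τ
  have hμ := h.1 s hs hs'
  have hshift : ContDiff ℝ ∞ fun τ => μ s (τ + Pi.single k (u s)) :=
    hμ.comp (contDiff_fun_id.add contDiff_const)
  have hsub : iteratedFDeriv ℝ p (fun τ => μ s (τ + Pi.single k (u s)) - μ s τ) τ' =
      iteratedFDeriv ℝ p (μ s) (τ' + Pi.single k (u s)) - iteratedFDeriv ℝ p (μ s) τ' := by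
    rw [← iteratedFDeriv_comp_add_right]
    exact iteratedFDeriv_sub_apply (hshift.of_le (by exact_mod_cast le_top)).contDiffAt
      (hμ.of_le (by exact_mod_cast le_top)).contDiffAt
  rw [hsub]
  have hmv := Convex.norm_image_sub_le_of_norm_fderiv_le (𝕜 := ℝ) (f := iteratedFDeriv ℝ p (μ s))
    (C := c * s ^ n) (s := univ) (x := τ') (y := τ' + Pi.single k (u s))
    (fun x _ => (hμ.differentiable_iteratedFDeriv (by exact_mod_cast WithTop.coe_lt_top p)) x)
    (fun x _ => by rw [norm_fderiv_iteratedFDeriv]; exact hc s hs hs' x)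
    convex_univ (mem_univ _) (mem_univ _)
  refine hmv.trans ?_
  rw [add_sub_cancel_left, Pi.norm_single, pow_succ, ← mul_assoc]
  refine mul_le_mul_of_nonneg_left (hu s hs hs') ?_
  exact (norm_nonneg _).trans (hc s hs hs' τ')

end Symbols

/-! ### Difference operators and their product rule -/

section Leibniz

variable {H : Type*} [NormedAddCommGroup H] {ι : Type*} [DecidableEq ι]

/-- The product of the difference operators with step `σ` along a list of variables. -/
def diffList (L : List ι) (σ : ℝ) (F : (ι → ℝ) → H) : (ι → ℝ) → H :=
  L.foldr (fun i F => diffOp i σ F) F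

@[simp] theorem diffList_nil (σ : ℝ) (F : (ι → ℝ) → H) : diffList [] σ F = F := rfl

@[simp] theorem diffList_cons (i : ι) (L : List ι) (σ : ℝ) (F : (ι → ℝ) → H) :
    diffList (i :: L) σ F = diffOp i σ (diffList L σ F) := rfl

theorem diffList_sum {κ : Type*} (s : Finset κ) (L : List ι) (σ : ℝ) (F : κ → (ι → ℝ) → H)
    (τ : ι → ℝ) : diffList L σ (fun τ => ∑ k ∈ s, F k τ) τ = ∑ k ∈ s, diffList L σ (F k) τ := by
  induction L generalizing τ with
  | nil => rfl
  | cons i L ih => simp [diffOp, ih]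

theorem norm_diffList_le {L : List ι} {σ C : ℝ} {S : Set (ι → ℝ)}
    (hS : ∀ i ∈ L, ∀ τ ∈ S, Function.update τ i σ ∈ S ∧ Function.update τ i 0 ∈ S)
    {F : (ι → ℝ) → H} (hF : ∀ τ ∈ S, ‖F τ‖ ≤ C) :
    ∀ τ ∈ S, ‖diffList L σ F τ‖ ≤ 2 ^ L.length * C := by
  induction L with
  | nil => simpa using hF
  | cons i L ih =>
    intro τ hτ
    have ih' := ih fun j hj => hS j (by simp [hj])
    obtain ⟨h1, h2⟩ := hS i (by simp) τ hτ
    refine (norm_sub_le _ _).trans ((add_le_add (ih' _ h1) (ih' _ h2)).trans_eq ?_)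
    rw [List.length_cons, pow_succ]
    ring

theorem continuousOn_diffList {L : List ι} {σ : ℝ} {S : Set (ι → ℝ)}
    (hS : ∀ i ∈ L, ∀ τ ∈ S, Function.update τ i σ ∈ S ∧ Function.update τ i 0 ∈ S)
    {F : (ι → ℝ) → H} (hF : ContinuousOn F S) : ContinuousOn (diffList L σ F) S := by
  induction L with
  | nil => exact hF
  | cons i L ih =>
    have ih' := ih fun j hj => hS j (by simp [hj])
    refine ContinuousOn.sub ?_ ?_
    · exact ih'.comp (continuous_id.update i continuous_const).continuousOn
        fun τ hτ => (hS i (by simp) τ hτ).1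
    · exact ih'.comp (continuous_id.update i continuous_const).continuousOn
        fun τ hτ => (hS i (by simp) τ hτ).2

variable [InnerProductSpace ℂ H]

theorem isGeneratorValue_diffList {T : ℝ → H →L[ℂ] H} {L : List ι} {σ : ℝ} {S : Set (ι → ℝ)}
    (hS : ∀ i ∈ L, ∀ τ ∈ S, Function.update τ i σ ∈ S ∧ Function.update τ i 0 ∈ S)
    {F G : (ι → ℝ) → H} (hF : ∀ τ ∈ S, IsGeneratorValue T (F τ) (G τ)) :
    ∀ τ ∈ S, IsGeneratorValue T (diffList L σ F τ) (diffList L σ G τ) := by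
  induction L with
  | nil => exact hF
  | cons i L ih =>
    intro τ hτ
    have ih' := ih fun j hj => hS j (by simp [hj])
    obtain ⟨h1, h2⟩ := hS i (by simp) τ hτ
    exact (ih' _ h1).sub (ih' _ h2)

theorem hasDerivAt_diffList {L : List ι} {σ : ℝ} {S : Set (ι → ℝ)}
    (hS : ∀ i ∈ L, ∀ τ ∈ S, Function.update τ i σ ∈ S ∧ Function.update τ i 0 ∈ S) {k : ι}
    (hk : k ∉ L) {F G : (ι → ℝ) → H}
    (hF : ∀ τ ∈ S, HasDerivAt (fun y => F (Function.update τ k y)) (G τ) (τ k)) :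
    ∀ τ ∈ S, HasDerivAt (fun y => diffList L σ F (Function.update τ k y))
      (diffList L σ G τ) (τ k) := by
  induction L with
  | nil => exact hF
  | cons i L ih =>
    intro τ hτ
    simp only [List.mem_cons, not_or] at hk
    have ih' := ih (fun j hj => hS j (by simp [hj])) hk.2
    obtain ⟨h1, h2⟩ := hS i (by simp) τ hτ
    have e1 := ih' _ h1
    have e2 := ih' _ h2
    rw [Function.update_of_ne hk.1] at e1 e2
    simp only [Function.update_comm (Ne.symm hk.1)] at e1 e2
    exact e1.sub e2

/-- The Leibniz rule for products of difference operators, at points where the variables in which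
the differences are taken vanish. -/
theorem exists_leibniz [Fintype ι] {s₀ : ℝ} {u : ℝ → ℝ} (hu : ∀ s, 0 < s → s ≤ s₀ → |u s| ≤ s)
    {Z : ℝ → (ι → ℝ) → ℂ} (hZ : IsSymbol s₀ 0 Z) {L : List ι} (hL : L.Nodup) :
    ∃ W : List (List ι × (ℝ → (ι → ℝ) → ℂ)),
      (∀ w ∈ W, w.1.Sublist L ∧ IsSymbol s₀ (L.length - w.1.length) w.2) ∧
      ∀ (F : (ι → ℝ) → H) (s : ℝ) (τ : ι → ℝ), (∀ i ∈ L, τ i = 0) →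
        diffList L (u s) (fun τ => Z s τ • F τ) τ =
          (W.map fun w => w.2 s τ • diffList w.1 (u s) F τ).sum := by
  induction L with
  | nil => exact ⟨[([], Z)], by simpa using hZ, fun F s τ _ => by simp⟩
  | cons i L ih =>
    rw [List.nodup_cons] at hL
    obtain ⟨W, hW, hWF⟩ := ih hL.2
    -- Product rule `Δ(ZF) = Z|_{τ_i = u} ΔF + (ΔZ) F|_{τ_i = 0}`. Each difference thus either stays
    -- on `F` or falls on the coefficient and raises its order by one.
    refine ⟨W.map (fun w => (i :: w.1, fun s τ => w.2 s (Function.update τ i (u s)))) ++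
      W.map (fun w => (w.1, fun s => diffOp i (u s) (w.2 s))), ?_, ?_⟩
    · intro w hw
      rw [List.mem_append, List.mem_map, List.mem_map] at hw
      rcases hw with ⟨w', hw', rfl⟩ | ⟨w', hw', rfl⟩
      · obtain ⟨h1, h2⟩ := hW w' hw'
        refine ⟨h1.cons_cons i, ?_⟩
        simpa using h2.shift i u
      · obtain ⟨h1, h2⟩ := hW w' hw'
        refine ⟨h1.cons i, ?_⟩
        have h3 := h2.diffOp i hu
        rwa [← Nat.sub_add_comm h1.length_le] at h3
    · intro F s τ hτ
      have hτi : Function.update τ i 0 = τ := by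
        rw [← hτ i (by simp), Function.update_eq_self]
      have hτL : ∀ y, ∀ j ∈ L, Function.update τ i y j = 0 := fun y j hj => by
        rw [Function.update_of_ne (by rintro rfl; exact hL.1 hj)]
        exact hτ j (by simp [hj])
      rw [diffList_cons, diffOp, hWF F s _ (hτL _), hWF F s _ (hτL _), hτi, List.map_append,
        List.map_map, List.map_map, List.sum_append]
      clear hWF hW
      induction W with
      | nil => simp
      | cons w W ihW =>
        simp only [List.map_cons, List.sum_cons, Function.comp] at ihW ⊢
        rw [add_sub_add_comm, ihW]
        simp only [diffList_cons, diffOp, hτi, smul_sub, sub_smul]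
        abel

end Leibniz

/-! ### Integration by parts on exhausting cubes -/

section Limits

/-- A sequence in `(0, 1)` tending to `0`. -/
noncomputable def thetaSeq (n : ℕ) : unitInterval :=
  -- The denominator `n + 2` keeps even the first term below `1`, so that no cube degenerates.
  ⟨1 / ((n : ℝ) + 1 + 1), by positivity, by
    rw [div_le_one (by positivity)]
    have : (0 : ℝ) ≤ n := n.cast_nonneg
    linarith⟩

theorem thetaSeq_pos (n : ℕ) : 0 < (thetaSeq n : ℝ) := by
  simp only [thetaSeq]; positivity

theorem thetaSeq_lt_one (n : ℕ) : (thetaSeq n : ℝ) < 1 := by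
  simp only [thetaSeq]
  rw [div_lt_one (by positivity)]
  have : (0 : ℝ) ≤ n := n.cast_nonneg
  linarith

theorem tendsto_thetaSeq : Tendsto thetaSeq atTop (𝓝 0) := by
  rw [tendsto_subtype_rng]
  have h := (tendsto_add_atTop_iff_nat 1).2 (tendsto_one_div_add_atTop_nhds_zero_nat (𝕜 := ℝ))
  simpa [thetaSeq] using h

variable {E : Type*} [NormedAddCommGroup E] {ι : Type*} [DecidableEq ι] [Fintype ι]

omit [Fintype ι] in
theorem continuous_comp_cubePoint {M : Finset ι} {σ : ℝ} (hσ : 0 ≤ σ) {P : (ι → ℝ) → E}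
    (hP : ContinuousOn P {τ | ∀ i, 0 ≤ τ i}) :
    Continuous fun q : unitInterval × (ι → unitInterval) => P (cubePoint M q.1 σ q.2) :=
  hP.comp_continuous (continuous_cubePoint M σ) fun q i => (cubePoint_mem q.1.2 hσ q.2 i).1

omit [Fintype ι] in
theorem continuous_comp_update_cubePoint {M : Finset ι} {σ : ℝ} (hσ : 0 ≤ σ) {P : (ι → ℝ) → E}
    (hP : ContinuousOn P {τ | ∀ i, 0 ≤ τ i}) (k : ι) {u : unitInterval → ℝ} (hu : Continuous u)
    (hu0 : ∀ θ, 0 ≤ u θ) : Continuous fun q : unitInterval × (ι → unitInterval) =>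
      P (Function.update (cubePoint M q.1 σ q.2) k (u q.1)) := by
  refine hP.comp_continuous ((continuous_cubePoint M σ).update k (hu.comp continuous_fst)) ?_
  intro q i
  rcases eq_or_ne i k with rfl | hi
  · simpa using hu0 q.1
  · simpa [hi] using (cubePoint_mem q.1.2 hσ q.2 i).1

omit [DecidableEq ι] in
theorem tendsto_integral_cubePoint [NormedSpace ℝ E] {f : unitInterval × (ι → unitInterval) → E}
    (hf : Continuous f) :
    Tendsto (fun n => ∫ x, f (thetaSeq n, x)) atTop (𝓝 (∫ x, f (0, x))) :=
  ((continuous_integral_cube hf).tendsto 0).comp tendsto_thetaSeq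

variable [NormedSpace ℂ E] [CompleteSpace E]

omit [CompleteSpace E] in
theorem integrable_smul_cubePoint {M : Finset ι} {k : ι}
    {σ : ℝ} (hσ : 0 ≤ σ) {θ : unitInterval} {φ : (ι → ℝ) → ℂ} (hφ : Continuous φ)
    {P Q : (ι → ℝ) → E} (hP : ContinuousOn P {τ | ∀ i, 0 ≤ τ i})
    (hPQ : ∀ x : ι → unitInterval, HasDerivAt (fun y => P (Function.update (cubePoint M θ σ x) k y))
      (Q (cubePoint M θ σ x)) (cubePoint M θ σ x k))
    {C : ℝ} (hC : ∀ x : ι → unitInterval, ‖Q (cubePoint M θ σ x)‖ ≤ C) :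
    Integrable fun x => φ (cubePoint M θ σ x) • Q (cubePoint M θ σ x) := by
  have hcp : Continuous fun x : ι → unitInterval => cubePoint M θ σ x :=
    (continuous_cubePoint M σ).comp (Continuous.prodMk_right θ)
  have hφc : Continuous fun x : ι → unitInterval => φ (cubePoint M θ σ x) := hφ.comp hcp
  have hQ : Integrable fun x => Q (cubePoint M θ σ x) :=
    Integrable.of_bound (stronglyMeasurable_of_hasDerivAt θ.2 hσ hP hPQ).aestronglyMeasurable C
      (Eventually.of_forall hC)
  obtain ⟨B, hB⟩ := (isCompact_range hφc).isBounded.exists_norm_le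
  exact hQ.bdd_smul B hφc.stronglyMeasurable.aestronglyMeasurable
    (Eventually.of_forall fun x => hB _ (mem_range_self x))

/-- Integration by parts in one variable over cubes that exhaust `[0, σ]^ι`, in the limit. -/
theorem tendsto_integral_by_parts {M : Finset ι} {k : ι} (hk : k ∉ M)
    {σ : ℝ} (hσ : 0 < σ) {φ : (ι → ℝ) → ℂ} (hφ : ContDiff ℝ ∞ φ)
    {P Q : (ι → ℝ) → E} (hP : ContinuousOn P {τ | ∀ i, 0 ≤ τ i})
    (hPQ : ∀ n, ∀ x : ι → unitInterval,
      HasDerivAt (fun y => P (Function.update (cubePoint M (thetaSeq n) σ x) k y))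
      (Q (cubePoint M (thetaSeq n) σ x)) (cubePoint M (thetaSeq n) σ x k))
    (hC : ∀ n, ∃ C, ∀ x : ι → unitInterval, ‖Q (cubePoint M (thetaSeq n) σ x)‖ ≤ C) :
    Tendsto (fun n => ∫ x, φ (cubePoint M (thetaSeq n) σ x) • Q (cubePoint M (thetaSeq n) σ x))
      atTop (𝓝 (σ⁻¹ • (∫ x, diffOp k σ (fun τ => φ τ • P τ) (cubePoint M 0 σ x)) -
        ∫ x, fderiv ℝ φ (cubePoint M 0 σ x) (Pi.single k 1) • P (cubePoint M 0 σ x))) := by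
  have hφ' : Continuous fun τ => fderiv ℝ φ τ (Pi.single k 1) :=
    (hφ.continuous_fderiv (by simp)).clm_apply continuous_const
  have hφP : ContinuousOn (fun τ => φ τ • P τ) {τ | ∀ i, 0 ≤ τ i} :=
    hφ.continuous.continuousOn.smul hP
  have hdP : ContinuousOn (fun τ => fderiv ℝ φ τ (Pi.single k 1) • P τ) {τ | ∀ i, 0 ≤ τ i} :=
    hφ'.continuousOn.smul hP
  have hbd : Continuous fun q : unitInterval × (ι → unitInterval) =>
      (fun τ => φ τ • P τ) (Function.update (cubePoint M q.1 σ q.2) k σ) -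
        (fun τ => φ τ • P τ) (Function.update (cubePoint M q.1 σ q.2) k (σ * q.1)) :=
    (continuous_comp_update_cubePoint hσ.le hφP k continuous_const fun _ => hσ.le).sub
      (continuous_comp_update_cubePoint (u := fun θ => σ * θ) hσ.le hφP k (by fun_prop)
        fun θ => mul_nonneg hσ.le θ.2.1)
  have hscal : Tendsto (fun n => (σ * (1 - (thetaSeq n : ℝ)))⁻¹) atTop (𝓝 σ⁻¹) := by
    have h1 : Tendsto (fun n => (thetaSeq n : ℝ)) atTop (𝓝 0) :=
      (continuous_subtype_val.tendsto (0 : unitInterval)).comp tendsto_thetaSeq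
    have h2 : Tendsto (fun n => σ * (1 - (thetaSeq n : ℝ))) atTop (𝓝 (σ * (1 - 0))) :=
      (tendsto_const_nhds.sub h1).const_mul σ
    rw [sub_zero, mul_one] at h2
    exact h2.inv₀ hσ.ne'
  have hlim := (hscal.smul (tendsto_integral_cubePoint hbd)).sub
    (tendsto_integral_cubePoint (continuous_comp_cubePoint (M := M) hσ.le hdP))
  simp only [Icc.coe_zero, mul_zero] at hlim
  refine hlim.congr fun n => ?_
  obtain ⟨C, hC⟩ := hC n
  have hi1 := integrable_smul_cubePoint hσ.le hφ.continuous hP (hPQ n) hC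
  have hi2 : Integrable fun x => fderiv ℝ φ (cubePoint M (thetaSeq n) σ x) (Pi.single k 1) •
      P (cubePoint M (thetaSeq n) σ x) :=
    integrable_cube ((continuous_comp_cubePoint hσ.le hdP).comp (Continuous.prodMk_right _))
  -- On each smaller cube this is the fundamental theorem for the product `φ • P`; only continuous
  -- functions remain after subtracting the term with `∂φ`, and these pass to the limit.
  have key := integral_cubePoint_of_hasDerivAt hk (thetaSeq_lt_one n) hσ
    (P := fun τ => φ τ • P τ)
    (Q := fun τ => φ τ • Q τ + fderiv ℝ φ τ (Pi.single k 1) • P τ) ?_ (hi1.add hi2)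
  · rw [← key, integral_add hi1 hi2, add_sub_cancel_right]
  · intro x
    set τ := cubePoint M (thetaSeq n) σ x
    have h1 : HasDerivAt (fun y => φ (Function.update τ k y)) (fderiv ℝ φ τ (Pi.single k 1))
        (τ k) := by
      have h2 := (hφ.differentiable (by simp)).differentiableAt (x := τ) |>.hasFDerivAt
      have h3 := hasDerivAt_update τ k (τ k)
      have h4 : HasFDerivAt φ (fderiv ℝ φ τ) (Function.update τ k (τ k)) := by
        rwa [Function.update_eq_self]
      exact h4.comp_hasDerivAt (τ k) h3
    have h5 : HasDerivAt (fun y => P (Function.update τ k y)) (Q τ) (τ k) := hPQ n x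
    have h6 := h1.smul h5
    rw [Function.update_eq_self] at h6
    exact h6

end Limits

/-! ### Cutting off the coefficients of the structure formula -/

section Coefficients

variable {H : Type*} [NormedAddCommGroup H] [InnerProductSpace ℂ H] {d : ℕ}
  {T : Fin d → ℝ → H →L[ℂ] H}

theorem isOpen_unitBall (d : ℕ) : IsOpen (unitBall d) :=
  isOpen_lt (by fun_prop) continuous_const

theorem Icc_subset_unitBall {R : ℝ} (hdR : (d : ℝ) * R ^ 2 < 1) :
    univ.pi (fun _ : Fin d => Icc (0 : ℝ) R) ⊆ unitBall d := by
  intro t ht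
  refine lt_of_le_of_lt ?_ hdR
  have : ∀ i ∈ Finset.univ, t i ^ 2 ≤ R ^ 2 := fun i _ =>
    pow_le_pow_left₀ (ht i (mem_univ i)).1 (ht i (mem_univ i)).2 2
  simpa using Finset.sum_le_card_nsmul _ _ _ this

/-- The structure formula holds on compact cubes inside the ball with coefficients that are
smooth and compactly supported on all of `ℝ^d`. -/
theorem exists_compactSupport_coefficients (hT : Admissible T) {R : ℝ}
    (hdR : (d : ℝ) * R ^ 2 < 1) :
    ∃ Z : Fin d → Fin d → (Fin d → ℝ) → ℂ,
      (∀ i k, ContDiff ℝ ∞ (Z i k) ∧ HasCompactSupport (Z i k)) ∧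
      ∀ i, ∀ f ∈ sobolev T 1, ∀ t : Fin d → ℝ, (∀ j, t j ∈ Icc 0 R) →
        IsGeneratorValue (T i) (orbit T f t) (∑ k, Z i k t • orbitPartial T f k t) := by
  obtain ⟨ζ, hζ, hform⟩ := hT.structure_formula
  have hK : IsCompact (univ.pi fun _ : Fin d => Icc (0 : ℝ) R) :=
    isCompact_univ_pi fun _ => isCompact_Icc
  obtain ⟨K', hK', hKK', hK'U⟩ := exists_compact_between hK (isOpen_unitBall d)
    (Icc_subset_unitBall hdR)
  -- Nothing is known of `ζ` outside the ball. The cutoff removes it there, and compact support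
  -- makes all derivatives bounded.
  obtain ⟨χ, hχ1, hχ0, -⟩ := exists_contMDiffMap_one_nhds_of_subset_interior
    (n := ⊤) (modelWithCornersSelf ℝ (Fin d → ℝ)) hK.isClosed hKK'
  have hχ : ContDiff ℝ ∞ χ := χ.contMDiff.contDiff
  have hzero : ∀ i k, ∀ t ∉ K', χ t • ζ i k t = 0 := fun i k t ht => by rw [hχ0 t ht, zero_smul]
  refine ⟨fun i k t => χ t • ζ i k t, fun i k => ⟨?_, ?_⟩, fun i f hf t ht => ?_⟩
  · refine contDiff_iff_contDiffAt.2 fun t => ?_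
    by_cases htU : t ∈ unitBall d
    · exact hχ.contDiffAt.smul ((hζ i k).contDiffAt ((isOpen_unitBall d).mem_nhds htU))
    · have h0 : (fun t => χ t • ζ i k t) =ᶠ[𝓝 t] fun _ => 0 := by
        filter_upwards [hK'.isClosed.isOpen_compl.mem_nhds fun h => htU (hK'U h)] with u hu
          using hzero i k u hu
      exact contDiffAt_const.congr_of_eventuallyEq h0
  · exact HasCompactSupport.intro hK' fun t ht => hzero i k t ht
  · have htK : t ∈ univ.pi fun _ : Fin d => Icc (0 : ℝ) R := fun j _ => ht j
    have h1 : χ t = 1 := hχ1.self_of_nhdsSet t htK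
    simpa [h1] using hform i f hf t (Icc_subset_unitBall hdR htK) fun j => (ht j).1

end Coefficients

/-! ### The integrals attached to a `TermIndex` -/

namespace TermIndex

variable {d r : ℕ}

/-- The linear map `τ ↦ (k_j (τ_{j,1} + ⋯ + τ_{j,r}))_j`. -/
noncomputable def argMap (a : TermIndex d r) : (Fin d × Fin r → ℝ) →L[ℝ] (Fin d → ℝ) :=
  ContinuousLinearMap.pi fun j =>
    (a.mult j : ℝ) • ∑ κ : Fin r, (ContinuousLinearMap.proj (j, κ) : (Fin d × Fin r → ℝ) →L[ℝ] ℝ)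

theorem argMap_apply (a : TermIndex d r) (τ : Fin d × Fin r → ℝ) (j : Fin d) :
    a.argMap τ j = (a.mult j : ℝ) * ∑ κ : Fin r, τ (j, κ) := by
  simp [argMap]

theorem argMap_update (a : TermIndex d r) (τ : Fin d × Fin r → ℝ) (k : Fin d) (κ : Fin r)
    (y : ℝ) : a.argMap (Function.update τ (k, κ) y) =
      Function.update (a.argMap τ) k (a.argMap τ k + a.mult k * (y - τ (k, κ))) := by
  have h : Function.update τ (k, κ) y = τ + Pi.single (k, κ) (y - τ (k, κ)) := by
    funext i
    rcases eq_or_ne i (k, κ) with rfl | hi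
    · simp
    · simp [hi]
  funext j
  rw [h, argMap_apply]
  rcases eq_or_ne j k with rfl | hj
  · simp [argMap_apply, Finset.sum_add_distrib, mul_add, Pi.single_apply]
  · simp [argMap_apply, hj]

theorem argMap_nonneg (a : TermIndex d r) {τ : Fin d × Fin r → ℝ} (hτ : ∀ i, 0 ≤ τ i)
    (j : Fin d) : 0 ≤ a.argMap τ j := by
  rw [argMap_apply]
  exact mul_nonneg (Nat.cast_nonneg _) (Finset.sum_nonneg fun κ _ => hτ _)

theorem le_argMap (a : TermIndex d r) {τ : Fin d × Fin r → ℝ} (hτ : ∀ i, 0 ≤ τ i)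
    (j : Fin d) (κ : Fin r) : τ (j, κ) ≤ a.argMap τ j := by
  rw [argMap_apply]
  have h1 : τ (j, κ) ≤ ∑ κ : Fin r, τ (j, κ) :=
    Finset.single_le_sum (f := fun κ => τ (j, κ)) (fun κ _ => hτ _) (Finset.mem_univ κ)
  refine h1.trans (le_mul_of_one_le_left ((hτ _).trans h1) ?_)
  exact_mod_cast a.one_le_mult j

theorem argMap_le (a : TermIndex d r) {τ : Fin d × Fin r → ℝ} {σ : ℝ}
    (hτ : ∀ i, τ i ∈ Icc 0 σ) (j : Fin d) : a.argMap τ j ≤ r * (r * σ) := by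
  rw [argMap_apply]
  have h1 : ∑ κ : Fin r, τ (j, κ) ≤ r * σ := by
    simpa using Finset.sum_le_card_nsmul Finset.univ (fun κ : Fin r => τ (j, κ)) σ
      fun κ _ => (hτ _).2
  exact mul_le_mul (by exact_mod_cast a.mult_le j) h1
    (Finset.sum_nonneg fun κ _ => (hτ _).1) (Nat.cast_nonneg _)

/-- Pigeonhole: a row has `r` variables. This is what allows `r` successive generators to be
applied. -/
theorem exists_free (a : TermIndex d r) (h : a.m < r) (k : Fin d) :
    ∃ κ : Fin r, (k, κ) ∉ a.frozen := by
  by_contra! hcon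
  have h1 : (Finset.univ.map ⟨fun κ : Fin r => (k, κ), Prod.mk_right_injective k⟩) ⊆ a.frozen := by
    intro x hx
    obtain ⟨κ, -, rfl⟩ := Finset.mem_map.1 hx
    exact hcon κ
  have h2 := Finset.card_le_card h1
  rw [Finset.card_map, Finset.card_univ, Fintype.card_fin] at h2
  exact absurd h (not_lt.2 h2)

/-- The same multipliers and frozen variables, with fewer differences. -/
def withDiffs (a : TermIndex d r) (L : List (Fin d × Fin r)) (hL : L.Sublist a.diffs) :
    TermIndex d r :=
  { a with
    diffs := L
    diffs_nodup := hL.nodup a.diffs_nodup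
    diffs_subset := fun x hx => a.diffs_subset x (hL.subset hx) }

/-- One more frozen variable. -/
def freeze (a : TermIndex d r) (x : Fin d × Fin r) : TermIndex d r :=
  { a with
    frozen := insert x a.frozen
    diffs_subset := fun y hy => Finset.mem_insert_of_mem (a.diffs_subset y hy) }

/-- One more frozen variable, in which moreover a difference is taken. -/
def freezeDiff (a : TermIndex d r) (x : Fin d × Fin r) (hx : x ∉ a.frozen) : TermIndex d r :=
  { a with
    frozen := insert x a.frozen
    diffs := x :: a.diffs
    diffs_nodup := List.nodup_cons.2 ⟨fun h => hx (a.diffs_subset x h), a.diffs_nodup⟩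
    diffs_subset := fun y hy => by
      rcases List.mem_cons.1 hy with rfl | hy
      · exact Finset.mem_insert_self _ _
      · exact Finset.mem_insert_of_mem (a.diffs_subset y hy) }

variable {H : Type*} [NormedAddCommGroup H] [InnerProductSpace ℂ H] {T : Fin d → ℝ → H →L[ℂ] H}

theorem orbitFun_eq (a : TermIndex d r) (f : H) (τ : Fin d × Fin r → ℝ) :
    a.orbitFun T f τ = orbit T f (a.argMap τ) := by
  unfold orbitFun
  congr 1
  funext j
  rw [argMap_apply]

/-- The derivative of `orbitFun` with respect to any of the variables `τ_{k,κ}`. -/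
noncomputable def partialFun (a : TermIndex d r) (T : Fin d → ℝ → H →L[ℂ] H) (f : H) (k : Fin d)
    (τ : Fin d × Fin r → ℝ) : H :=
  (a.mult k : ℝ) • orbitPartial T f k (a.argMap τ)

theorem continuousOn_orbitFun (hT : ∀ i, IsContractionSemigroup (T i)) (a : TermIndex d r)
    (f : H) : ContinuousOn (a.orbitFun T f) {τ | ∀ i, 0 ≤ τ i} := by
  refine ((continuousOn_orbit hT f).comp a.argMap.continuous.continuousOn
    fun τ hτ => a.argMap_nonneg hτ).congr fun τ _ => ?_
  exact a.orbitFun_eq f τ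

theorem orthant_update {ι : Type*} [DecidableEq ι] {σ : ℝ} (hσ : 0 ≤ σ) (i : ι) (τ : ι → ℝ)
    (hτ : τ ∈ {τ : ι → ℝ | ∀ i, 0 ≤ τ i}) :
    Function.update τ i σ ∈ {τ : ι → ℝ | ∀ i, 0 ≤ τ i} ∧
      Function.update τ i 0 ∈ {τ : ι → ℝ | ∀ i, 0 ≤ τ i} := by
  constructor <;> intro j <;> rcases eq_or_ne j i with rfl | hj
  · simpa using hσ
  · simpa [hj] using hτ j
  · simp
  · simpa [hj] using hτ j

theorem continuousOn_diffList_orbitFun (hT : ∀ i, IsContractionSemigroup (T i))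
    (a : TermIndex d r) (L : List (Fin d × Fin r)) {σ : ℝ} (hσ : 0 ≤ σ) (f : H) :
    ContinuousOn (diffList L σ (a.orbitFun T f)) {τ | ∀ i, 0 ≤ τ i} :=
  continuousOn_diffList (fun i _ τ hτ => orthant_update hσ i τ hτ) (a.continuousOn_orbitFun hT f)

/-- The volume factor `(s/r)^(rd-m)` of the free cube leaves `(s/r)^(-m)` of the normalisation. -/
theorem integralTerm_eq (hT : ∀ i, IsContractionSemigroup (T i)) (a : TermIndex d r)
    {μ : (Fin d × Fin r → ℝ) → ℂ} (hμ : Continuous μ) {s : ℝ} (hs : 0 < s / r) (f : H) :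
    a.integralTerm T μ s f = ((s / r) ^ a.m)⁻¹ • ∫ x : Fin d × Fin r → unitInterval,
      μ (cubePoint a.frozen 0 (s / r) x) •
        diffList a.diffs (s / r) (a.orbitFun T f) (cubePoint a.frozen 0 (s / r) x) := by
  have hg : ContinuousOn (fun τ => μ τ • a.diffOrbitFun T f (s / r) τ)
      {τ | ∀ i, τ i ∈ Icc 0 (s / r)} :=
    hμ.continuousOn.smul ((continuousOn_diffList_orbitFun hT a a.diffs hs.le f).mono
      fun τ hτ i => (hτ i).1)
  have h := setIntegral_extend a.frozen hs hg
  have hm : a.m ≤ r * d := by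
    have := Finset.card_le_univ a.frozen
    rwa [Fintype.card_prod, Fintype.card_fin, Fintype.card_fin, mul_comm] at this
  unfold integralTerm
  change ((s / r) ^ (r * d))⁻¹ • (∫ τ in univ.pi (fun _ : {x // x ∉ a.frozen} => Icc 0 (s / r)),
    (fun τ => μ τ • a.diffOrbitFun T f (s / r) τ)
      (fun x => if h : x ∉ a.frozen then τ ⟨x, h⟩ else 0)) = _
  rw [h, smul_smul, Fintype.card_prod, Fintype.card_fin, Fintype.card_fin, mul_comm d r]
  congr 1
  rw [show a.frozen.card = a.m from rfl, pow_sub₀ _ hs.ne' hm, inv_mul_cancel_left₀ (by positivity)]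

theorem norm_diffList_orbitFun_sub_le (hT : ∀ i, IsContractionSemigroup (T i))
    (a : TermIndex d r) (L : List (Fin d × Fin r)) {σ : ℝ} (hσ : 0 ≤ σ) (f g : H)
    {τ : Fin d × Fin r → ℝ} (hτ : ∀ i, 0 ≤ τ i) :
    ‖diffList L σ (a.orbitFun T f) τ - diffList L σ (a.orbitFun T g) τ‖ ≤
      2 ^ L.length * ‖f - g‖ := by
  have hsub : ∀ τ, diffList L σ (a.orbitFun T f) τ - diffList L σ (a.orbitFun T g) τ =
      diffList L σ (a.orbitFun T (f - g)) τ := by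
    induction L with
    | nil =>
      intro τ
      simp only [diffList_nil, orbitFun, orbit_eq_orbitList, orbitList_sub]
    | cons i L ih =>
      intro τ
      simp only [diffList_cons, diffOp, ← ih]
      abel
  rw [hsub]
  refine norm_diffList_le (S := {τ | ∀ i, 0 ≤ τ i}) (fun i _ τ hτ => orthant_update hσ i τ hτ)
    (fun τ hτ => ?_) τ hτ
  rw [orbitFun_eq]
  exact norm_orbitList_le hT _ (a.argMap_nonneg hτ) _

theorem integrable_term (hT : ∀ i, IsContractionSemigroup (T i)) (a : TermIndex d r)
    {μ : (Fin d × Fin r → ℝ) → ℂ} (hμ : Continuous μ) {σ : ℝ} (hσ : 0 ≤ σ) (θ : unitInterval)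
    (M : Finset (Fin d × Fin r)) (L : List (Fin d × Fin r)) (f : H) :
    Integrable fun x : Fin d × Fin r → unitInterval =>
      μ (cubePoint M θ σ x) • diffList L σ (a.orbitFun T f) (cubePoint M θ σ x) :=
  integrable_cube ((continuous_comp_cubePoint hσ (P := fun τ => μ τ • diffList L σ
    (a.orbitFun T f) τ) (hμ.continuousOn.smul (continuousOn_diffList_orbitFun hT a L hσ f))).comp
      (Continuous.prodMk_right θ))

/-- Contractivity bounds the integrand by a constant times the norm of `f`; the continuity serves to
pass from `H¹` to `H` by density. -/
theorem continuous_integralTerm (hT : ∀ i, IsContractionSemigroup (T i)) (a : TermIndex d r)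
    {μ : (Fin d × Fin r → ℝ) → ℂ} (hμ : Continuous μ) {s : ℝ} (hs : 0 < s / r) :
    Continuous fun f : H => a.integralTerm T μ s f := by
  simp only [integralTerm_eq hT a hμ hs]
  refine Continuous.const_smul ?_ _
  have hμc : Continuous fun x : Fin d × Fin r → unitInterval =>
      μ (cubePoint a.frozen 0 (s / r) x) :=
    hμ.comp ((continuous_cubePoint a.frozen (s / r)).comp (Continuous.prodMk_right 0))
  obtain ⟨B, hB⟩ := (isCompact_range hμc).isBounded.exists_norm_le
  have hB0 : 0 ≤ B := (norm_nonneg _).trans (hB _ (mem_range_self 0))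
  refine (LipschitzWith.of_dist_le_mul (K := ⟨B * 2 ^ a.diffs.length, by positivity⟩)
    fun f g => ?_).continuous
  have hi := fun f : H => integrable_term hT a hμ hs.le 0 a.frozen a.diffs f
  simp only [Icc.coe_zero] at hi
  rw [dist_eq_norm, dist_eq_norm, ← integral_sub (hi f) (hi g)]
  refine (norm_integral_le_of_norm_le_const (C := B * 2 ^ a.diffs.length * ‖f - g‖)
    (Eventually.of_forall fun x => ?_)).trans_eq
      (by rw [probReal_univ, mul_one]; rfl)
  rw [← smul_sub, norm_smul, mul_assoc]
  exact mul_le_mul (hB _ (mem_range_self x)) (norm_diffList_orbitFun_sub_le hT a _ hs.le f g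
    fun i => (cubePoint_mem ⟨le_rfl, zero_le_one⟩ hs.le x i).1) (norm_nonneg _) hB0

variable [CompleteSpace H]

theorem hasDerivAt_orbitFun (hT : Admissible T) (a : TermIndex d r) {f : H}
    (hf : f ∈ sobolev T 1) (k : Fin d) (κ : Fin r) {τ : Fin d × Fin r → ℝ} (hτ : ∀ i, 0 ≤ τ i)
    (hκ : 0 < τ (k, κ)) :
    HasDerivAt (fun y => a.orbitFun T f (Function.update τ (k, κ) y)) (a.partialFun T f k τ)
      (τ (k, κ)) := by
  have hpos : 0 < a.argMap τ k := hκ.trans_le (a.le_argMap hτ k κ)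
  have h1 := (hasDerivWithinAt_orbit hT hf k (a.argMap_nonneg hτ) hpos.le).hasDerivAt
    (Ici_mem_nhds hpos)
  rw [Function.update_eq_self] at h1
  have h2 : HasDerivAt (fun y => a.argMap τ k + a.mult k * (y - τ (k, κ))) (a.mult k : ℝ)
      (τ (k, κ)) := by
    simpa using (((hasDerivAt_id (τ (k, κ))).sub_const _).const_mul (a.mult k : ℝ)).const_add
      (a.argMap τ k)
  have h3 : HasDerivAt (fun x => orbit T f (Function.update (a.argMap τ) k x))
      (orbitPartial T f k (a.argMap τ)) (a.argMap τ k + a.mult k * (τ (k, κ) - τ (k, κ))) := by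
    simpa using h1
  have h4 := h3.scomp (τ (k, κ)) h2
  refine h4.congr_of_eventuallyEq (Eventually.of_forall fun y => ?_)
  simp only [Function.comp, orbitFun_eq, argMap_update]

/-- A free variable in each row keeps every time at least `σθ`, even when other variables of the row
are `0`, so the bound on compact subsets of the open orthant applies. -/
theorem exists_partialFun_bound (hT : Admissible T) (a : TermIndex d r) (ha : a.m < r) {f : H}
    (hf : f ∈ sobolev T 1) (k : Fin d) {σ θ : ℝ} (hσ : 0 < σ) (hθ : 0 < θ) :
    ∃ C, ∀ τ : Fin d × Fin r → ℝ, (∀ i, τ i ∈ Icc 0 σ) → (∀ i ∉ a.frozen, σ * θ ≤ τ i) →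
      ‖a.partialFun T f k τ‖ ≤ C := by
  obtain ⟨C, hC⟩ := exists_orbitPartial_bound hT hf k (mul_pos hσ hθ) (r * (r * σ))
  refine ⟨a.mult k * C, fun τ hτ hτ' => ?_⟩
  rw [partialFun, norm_smul, Real.norm_of_nonneg (Nat.cast_nonneg _)]
  refine mul_le_mul_of_nonneg_left (hC _ fun j => ⟨?_, a.argMap_le hτ j⟩) (Nat.cast_nonneg _)
  obtain ⟨κ, hκ⟩ := a.exists_free ha j
  exact (hτ' _ hκ).trans (a.le_argMap (fun i => (hτ i).1) j κ)

end TermIndex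

/-! ### Integration by parts for a single term -/

section Steps

variable {d r : ℕ} {H : Type*} [NormedAddCommGroup H] [InnerProductSpace ℂ H]
  {T : Fin d → ℝ → H →L[ℂ] H} {s₀ : ℝ}

/-- Finite sums of the integrals `integralTerm` with at most `n` frozen variables and with
coefficients of the order prescribed by the numbers of frozen variables and of differences. -/
def termSums (T : Fin d → ℝ → H →L[ℂ] H) (r : ℕ) (s₀ : ℝ) (n : ℕ) : AddSubmonoid (ℝ → H → H) :=
  AddSubmonoid.closure {A | ∃ (a : TermIndex d r) (μ : ℝ → (Fin d × Fin r → ℝ) → ℂ),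
    a.m ≤ n ∧ IsSymbol s₀ (a.m - a.l) μ ∧ A = fun s f => a.integralTerm T (μ s) s f}

theorem integralTerm_mem_termSums {n : ℕ} (a : TermIndex d r) (ha : a.m ≤ n)
    {μ : ℝ → (Fin d × Fin r → ℝ) → ℂ} (hμ : IsSymbol s₀ (a.m - a.l) μ) :
    (fun s f => a.integralTerm T (μ s) s f) ∈ termSums T r s₀ n :=
  AddSubmonoid.subset_closure ⟨a, μ, ha, hμ, rfl⟩

theorem termSums_mono {n n' : ℕ} (h : n ≤ n') : termSums T r s₀ n ≤ termSums T r s₀ n' :=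
  AddSubmonoid.closure_mono fun _ ⟨a, μ, ha, hμ, hA⟩ => ⟨a, μ, ha.trans h, hμ, hA⟩

theorem continuous_of_mem_termSums (hT : ∀ i, IsContractionSemigroup (T i)) (hr : 1 ≤ r) {n : ℕ}
    {A : ℝ → H → H} (hA : A ∈ termSums T r s₀ n) {s : ℝ} (hs : 0 < s) (hs' : s ≤ s₀) :
    Continuous (A s) := by
  induction hA using AddSubmonoid.closure_induction with
  | mem A h =>
    obtain ⟨a, μ, -, hμ, rfl⟩ := h
    exact a.continuous_integralTerm hT (hμ.1 s hs hs').continuous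
      (div_pos hs (by exact_mod_cast hr))
  | zero => exact continuous_const
  | add A B _ _ hA hB => exact hA.add hB

theorem tendsto_list_map_sum {X Y E : Type*} [AddCommMonoid E] [TopologicalSpace E]
    [ContinuousAdd E] {l : Filter X} (W : List Y) {f : Y → X → E} {g : Y → E}
    (h : ∀ w ∈ W, Tendsto (f w) l (𝓝 (g w))) :
    Tendsto (fun x => (W.map fun w => f w x).sum) l (𝓝 (W.map g).sum) :=
  tendsto_list_sum W h

theorem integral_list_map_sum {X Y E : Type*} [MeasurableSpace X] {m : Measure X}
    [NormedAddCommGroup E] [NormedSpace ℝ E] (W : List Y) {f : Y → X → E}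
    (h : ∀ w ∈ W, Integrable (f w) m) :
    Integrable (fun x => (W.map fun w => f w x).sum) m ∧
      ∫ x, (W.map fun w => f w x).sum ∂m = (W.map fun w => ∫ x, f w x ∂m).sum := by
  induction W with
  | nil => simp
  | cons w W ih =>
    simp only [List.mem_cons, forall_eq_or_imp] at h
    obtain ⟨h1, h2⟩ := ih h.2
    simp only [List.map_cons, List.sum_cons]
    exact ⟨h.1.add h1, by rw [integral_add h.1 h1, h2]⟩

variable [CompleteSpace H]

theorem cubePoint_nonneg {ι : Type*} [DecidableEq ι] {M : Finset ι} {σ : ℝ} (hσ : 0 ≤ σ)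
    (θ : unitInterval) (x : ι → unitInterval) (i : ι) : 0 ≤ cubePoint M θ σ x i :=
  (cubePoint_mem θ.2 hσ x i).1

namespace TermIndex

theorem hasDerivAt_diffList_orbitFun (hT : Admissible T) (a : TermIndex d r) {f : H}
    (hf : f ∈ sobolev T 1) {k : Fin d} {κ : Fin r} {L : List (Fin d × Fin r)}
    (hL : (k, κ) ∉ L) {σ : ℝ} (hσ : 0 ≤ σ) {τ : Fin d × Fin r → ℝ} (hτ : ∀ i, 0 ≤ τ i)
    (hκ : 0 < τ (k, κ)) :
    HasDerivAt (fun y => diffList L σ (a.orbitFun T f) (Function.update τ (k, κ) y))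
      (diffList L σ (a.partialFun T f k) τ) (τ (k, κ)) := by
  refine hasDerivAt_diffList (S := {τ | ∀ i, 0 ≤ τ i} ∩ {τ | 0 < τ (k, κ)}) ?_ hL
    (fun τ hτ => a.hasDerivAt_orbitFun hT hf k κ hτ.1 hτ.2) τ ⟨hτ, hκ⟩
  intro i hi τ hτ
  have hne : (k, κ) ≠ i := fun h => hL (h ▸ hi)
  obtain ⟨h1, h2⟩ := orthant_update hσ i τ hτ.1
  exact ⟨⟨h1, by simpa [hne] using hτ.2⟩, ⟨h2, by simpa [hne] using hτ.2⟩⟩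

/-- The points of the cube `[0, σ]^{rd}` whose free coordinates are at least `σθ` are stable
under the substitutions occurring in the difference operators. -/
theorem cube_update (a : TermIndex d r) {σ θ : ℝ} (hσ : 0 ≤ σ) {i : Fin d × Fin r}
    (hi : i ∈ a.frozen) (τ : Fin d × Fin r → ℝ)
    (hτ : τ ∈ {τ | (∀ i, τ i ∈ Icc 0 σ) ∧ ∀ i ∉ a.frozen, σ * θ ≤ τ i}) :
    Function.update τ i σ ∈ {τ | (∀ i, τ i ∈ Icc 0 σ) ∧ ∀ i ∉ a.frozen, σ * θ ≤ τ i} ∧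
      Function.update τ i 0 ∈ {τ | (∀ i, τ i ∈ Icc 0 σ) ∧ ∀ i ∉ a.frozen, σ * θ ≤ τ i} := by
  have key : ∀ y ∈ Icc 0 σ,
      Function.update τ i y ∈ {τ | (∀ i, τ i ∈ Icc 0 σ) ∧ ∀ i ∉ a.frozen, σ * θ ≤ τ i} := by
    refine fun y hy => ⟨fun j => ?_, fun j hj => ?_⟩
    · rcases eq_or_ne j i with rfl | h
      · simpa using hy
      · simpa [h] using hτ.1 j
    · have h : j ≠ i := fun h => hj (h ▸ hi)
      simpa [h] using hτ.2 j hj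
  exact ⟨key σ ⟨hσ, le_rfl⟩, key 0 ⟨le_rfl, hσ⟩⟩

theorem cubePoint_mem_cube (a : TermIndex d r) {σ : ℝ} (hσ : 0 ≤ σ) (θ : unitInterval)
    (x : Fin d × Fin r → unitInterval) : cubePoint a.frozen θ σ x ∈
      {τ | (∀ i, τ i ∈ Icc 0 σ) ∧ ∀ i ∉ a.frozen, σ * θ ≤ τ i} :=
  ⟨cubePoint_mem θ.2 hσ x, fun _ hi => le_cubePoint θ.2.2 hσ x hi⟩

theorem exists_diffList_partialFun_bound (hT : Admissible T) (a : TermIndex d r) (ha : a.m < r)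
    {f : H} (hf : f ∈ sobolev T 1) (k : Fin d) {L : List (Fin d × Fin r)}
    (hL : ∀ i ∈ L, i ∈ a.frozen) {σ : ℝ} (hσ : 0 < σ) {θ : unitInterval} (hθ : 0 < (θ : ℝ)) :
    ∃ C, ∀ x, ‖diffList L σ (a.partialFun T f k) (cubePoint a.frozen θ σ x)‖ ≤ C := by
  obtain ⟨C, hC⟩ := a.exists_partialFun_bound hT ha hf k hσ hθ
  exact ⟨_, fun x => norm_diffList_le
    (fun i hi τ hτ => a.cube_update (θ := θ) hσ.le (hL i hi) τ hτ)
    (fun τ hτ => hC τ hτ.1 hτ.2) _ (a.cubePoint_mem_cube hσ.le θ x)⟩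

/-- Integration by parts turns an integral containing a partial derivative of the orbit into a
sum of three integrals without derivatives. -/
theorem exists_tendsto_by_parts (hT : Admissible T) (hr : 1 ≤ r) (a : TermIndex d r)
    (ha : a.m < r) {k : Fin d} {κ : Fin r} (hx : (k, κ) ∉ a.frozen)
    {L : List (Fin d × Fin r)} (hL : L.Sublist a.diffs) {φ : ℝ → (Fin d × Fin r → ℝ) → ℂ}
    (hφ : IsSymbol s₀ (a.m - L.length) φ) :
    ∃ A ∈ termSums T r s₀ (a.m + 1), ∀ s, 0 < s → s ≤ s₀ → ∀ f ∈ sobolev T 1,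
      Tendsto (fun n => ((s / r) ^ a.m)⁻¹ • ∫ x, φ s (cubePoint a.frozen (thetaSeq n) (s / r) x) •
        diffList L (s / r) (a.partialFun T f k) (cubePoint a.frozen (thetaSeq n) (s / r) x))
        atTop (𝓝 (A s f)) := by
  have hrpos : (0 : ℝ) < r := by exact_mod_cast hr
  have hr1 : (1 : ℝ) ≤ r := by exact_mod_cast hr
  -- `b` carries the interior term. The boundary term `Δ(φF) = φ|_{τ = σ} ΔF + (Δφ) F|_{τ = 0}`
  -- gives `b₁`, with one more difference of the orbit, and `b₂`, with one more difference of the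
  -- coefficient.
  set b := a.withDiffs L hL with hb
  set b₁ := b.freezeDiff (k, κ) hx with hb₁
  set b₂ := b.freeze (k, κ) with hb₂
  have hLm : L.length ≤ a.m := hL.length_le.trans a.l_le_m
  have hLfr : ∀ i ∈ L, i ∈ a.frozen := fun i hi => a.diffs_subset i (hL.subset hi)
  have hxL : (k, κ) ∉ L := fun h => hx (hLfr _ h)
  have hm₁ : b₁.m = a.m + 1 := Finset.card_insert_of_notMem hx
  have hm₂ : b₂.m = a.m + 1 := Finset.card_insert_of_notMem hx
  have hl₁ : b₁.l = L.length + 1 := rfl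
  have hl₂ : b₂.l = L.length := rfl
  have hu : ∀ s : ℝ, 0 < s → s ≤ s₀ → |s / r| ≤ s := fun s hs _ => by
    rw [abs_of_pos (div_pos hs hrpos)]
    exact div_le_self hs.le hr1
  -- Here `m` and `l` both grow by one and the order is unchanged; for `b₂` only `m` grows, and the
  -- difference of `φ` supplies the missing factor `s`.
  have hφ₁ : IsSymbol s₀ (b₁.m - b₁.l) fun s τ => φ s (Function.update τ (k, κ) (s / r)) := by
    rw [hm₁, hl₁, Nat.add_sub_add_right]
    exact hφ.shift (k, κ) fun s => s / r
  have hφ₂ : IsSymbol s₀ (b₂.m - b₂.l) fun s => diffOp (k, κ) (s / r) (φ s) := by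
    rw [hm₂, hl₂, Nat.sub_add_comm hLm]
    exact hφ.diffOp (k, κ) hu
  have hφ₃ : IsSymbol s₀ (b.m - b.l) fun s τ => -fderiv ℝ (φ s) τ (Pi.single (k, κ) 1) :=
    (hφ.partialDeriv (k, κ)).neg
  refine ⟨_, add_mem (add_mem (integralTerm_mem_termSums b₁ hm₁.le hφ₁)
    (integralTerm_mem_termSums b₂ hm₂.le hφ₂))
    (integralTerm_mem_termSums b (Nat.le_succ _) hφ₃), fun s hs hs' f hf => ?_⟩
  have hσ : 0 < s / r := div_pos hs hrpos
  have hF := continuousOn_diffList_orbitFun hT.semigroup a L hσ.le f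
  have hlim := tendsto_integral_by_parts hx hσ (hφ.1 s hs hs') hF
    (Q := diffList L (s / r) (a.partialFun T f k))
    (fun n x => a.hasDerivAt_diffList_orbitFun hT hf hxL hσ.le
      (cubePoint_nonneg hσ.le (thetaSeq n) x)
      ((mul_pos hσ (thetaSeq_pos n)).trans_le
        (le_cubePoint (thetaSeq n).2.2 hσ.le x hx)))
    (fun n => a.exists_diffList_partialFun_bound hT ha hf k hLfr hσ (thetaSeq_pos n))
  have hlim' := hlim.const_smul ((s / r) ^ a.m)⁻¹
  convert hlim' using 2
  simp only [Pi.add_apply]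
  have hpt : ∀ x : Fin d × Fin r → unitInterval,
      φ s (Function.update (cubePoint b₁.frozen 0 (s / r) x) (k, κ) (s / r)) •
          diffList b₁.diffs (s / r) (b₁.orbitFun T f) (cubePoint b₁.frozen 0 (s / r) x) +
        diffOp (k, κ) (s / r) (φ s) (cubePoint b₂.frozen 0 (s / r) x) •
          diffList b₂.diffs (s / r) (b₂.orbitFun T f) (cubePoint b₂.frozen 0 (s / r) x) =
      diffOp (k, κ) (s / r) (fun τ => φ s τ • diffList L (s / r) (a.orbitFun T f) τ)
        (cubePoint a.frozen 0 (s / r) x) := by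
    intro x
    have h1 : cubePoint b₁.frozen 0 (s / r) x =
        Function.update (cubePoint a.frozen 0 (s / r) x) (k, κ) 0 := cubePoint_insert _ _ _ _
    have h2 : cubePoint b₂.frozen 0 (s / r) x =
        Function.update (cubePoint a.frozen 0 (s / r) x) (k, κ) 0 := cubePoint_insert _ _ _ _
    have h3 : diffList b₁.diffs (s / r) (b₁.orbitFun T f) =
        diffOp (k, κ) (s / r) (diffList L (s / r) (a.orbitFun T f)) := rfl
    have h4 : diffList b₂.diffs (s / r) (b₂.orbitFun T f) =
        diffList L (s / r) (a.orbitFun T f) := rfl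
    rw [h1, h2, h3, h4]
    simp only [diffOp, Function.update_idem, smul_sub, sub_smul]
    abel
  have hi₁ := b₁.integrable_term hT.semigroup (hφ₁.1 s hs hs').continuous hσ.le 0 b₁.frozen
    b₁.diffs f
  have hi₂ := b₂.integrable_term hT.semigroup (hφ₂.1 s hs hs').continuous hσ.le 0 b₂.frozen
    b₂.diffs f
  simp only [Icc.coe_zero] at hi₁ hi₂
  rw [b₁.integralTerm_eq hT.semigroup (hφ₁.1 s hs hs').continuous hσ,
    b₂.integralTerm_eq hT.semigroup (hφ₂.1 s hs hs').continuous hσ,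
    b.integralTerm_eq hT.semigroup (hφ₃.1 s hs hs').continuous hσ, hm₁, hm₂, ← smul_add,
    ← integral_add hi₁ hi₂]
  simp only [hpt, neg_smul, integral_neg, smul_neg, smul_sub, ← sub_eq_add_neg]
  -- The factor `(s/r)⁻¹` of the boundary term is exactly the one required by the additional frozen
  -- variable.
  rw [smul_smul, pow_succ, mul_inv]
  rfl

end TermIndex

end Steps

/-! ### Applying generators repeatedly -/

section Iteration

variable {d r : ℕ} {H : Type*} [NormedAddCommGroup H] [InnerProductSpace ℂ H] [CompleteSpace H]
  {T : Fin d → ℝ → H →L[ℂ] H} {s₀ : ℝ}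

theorem list_map_sum_apply {X Y Z E : Type*} [AddCommMonoid E] (W : List Z) (A : Z → X → Y → E)
    (x : X) (y : Y) : (W.map A).sum x y = (W.map fun w => A w x y).sum := by
  induction W with
  | nil => rfl
  | cons w W ih => simp [ih]

/-- On the smaller cubes the generator goes under the integral and becomes a sum of partial
derivatives by (c). Integration by parts gives the limit of the values, and closedness identifies it
as the generator value on the full cube. -/
theorem TermIndex.exists_generator_step (hT : Admissible T) (hr : 1 ≤ r)
    (hd : (d : ℝ) * (r * s₀) ^ 2 < 1) (a : TermIndex d r) (ha : a.m < r)
    {μ : ℝ → (Fin d × Fin r → ℝ) → ℂ} (hμ : IsSymbol s₀ (a.m - a.l) μ) (i : Fin d) :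
    ∃ A ∈ termSums T r s₀ (a.m + 1), ∀ s, 0 < s → s ≤ s₀ → ∀ f ∈ sobolev T 1,
      IsGeneratorValue (T i) (a.integralTerm T (μ s) s f) (A s f) := by
  have hrpos : (0 : ℝ) < r := by exact_mod_cast hr
  have hr1 : (1 : ℝ) ≤ r := by exact_mod_cast hr
  obtain ⟨Z, hZ, hform⟩ := exists_compactSupport_coefficients hT hd
  -- The inverse multiplier compensates the chain rule factor contained in `partialFun`.
  have hZsym : ∀ k, IsSymbol s₀ 0 fun (_ : ℝ) τ => ((a.mult k : ℂ))⁻¹ * Z i k (a.argMap τ) :=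
    fun k => (isSymbol_const _).mul (isSymbol_of_hasCompactSupport (hZ i k).1 (hZ i k).2 a.argMap)
  have hu : ∀ s : ℝ, 0 < s → s ≤ s₀ → |s / r| ≤ s := fun s hs _ => by
    rw [abs_of_pos (div_pos hs hrpos)]
    exact div_le_self hs.le hr1
  choose κ hκ using a.exists_free ha
  choose W hW hWF using fun k => exists_leibniz (H := H) hu (hZsym k) a.diffs_nodup
  have hsym : ∀ k, ∀ w ∈ W k, IsSymbol s₀ (a.m - w.1.length) fun s τ => μ s τ * w.2 s τ := by
    intro k w hw
    obtain ⟨h1, h2⟩ := hW k w hw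
    have h3 := hμ.mul h2
    have h4 : a.diffs.length ≤ a.m := a.l_le_m
    have h5 := h1.length_le
    -- The differences lost by the orbit are those gained by the coefficient; truncated subtraction
    -- is harmless since `w.1.length ≤ l ≤ m`.
    have h6 : a.m - a.l + (a.diffs.length - w.1.length) = a.m - w.1.length := by
      change a.m - a.diffs.length + _ = _
      omega
    rwa [h6] at h3
  have hparts : ∀ k, ∀ w ∈ W k, _ := fun k w hw =>
    a.exists_tendsto_by_parts hT hr ha (hκ k) (hW k w hw).1 (hsym k w hw)
  choose! A hA hAlim using hparts
  refine ⟨∑ k, ((W k).map (A k)).sum, sum_mem fun k _ => list_sum_mem fun B hB => ?_, ?_⟩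
  · obtain ⟨w, hw, rfl⟩ := List.mem_map.1 hB
    exact hA k w hw
  intro s hs hs' f hf
  have hσ : 0 < s / r := div_pos hs hrpos
  have hμc := (hμ.1 s hs hs').continuous
  have hv : Tendsto (fun n => ∑ k, ((W k).map fun w => ((s / r) ^ a.m)⁻¹ •
      ∫ x, (μ s (cubePoint a.frozen (thetaSeq n) (s / r) x) *
        w.2 s (cubePoint a.frozen (thetaSeq n) (s / r) x)) •
        diffList w.1 (s / r) (a.partialFun T f k)
          (cubePoint a.frozen (thetaSeq n) (s / r) x)).sum) atTop
      (𝓝 ((∑ k, ((W k).map (A k)).sum) s f)) := by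
    simp only [Finset.sum_apply, list_map_sum_apply]
    exact tendsto_finsetSum _ fun k _ => tendsto_list_map_sum _ fun w hw =>
      hAlim k w hw s hs hs' f hf
  have hu : Tendsto (fun n => ((s / r) ^ a.m)⁻¹ •
      ∫ x, μ s (cubePoint a.frozen (thetaSeq n) (s / r) x) •
        diffList a.diffs (s / r) (a.orbitFun T f) (cubePoint a.frozen (thetaSeq n) (s / r) x))
      atTop (𝓝 (a.integralTerm T (μ s) s f)) := by
    rw [a.integralTerm_eq hT.semigroup hμc hσ]
    exact (tendsto_integral_cubePoint (continuous_comp_cubePoint (M := a.frozen) hσ.le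
      (P := fun τ => μ s τ • diffList a.diffs (s / r) (a.orbitFun T f) τ)
      (hμc.continuousOn.smul
        (continuousOn_diffList_orbitFun hT.semigroup a a.diffs hσ.le f)))).const_smul _
  refine IsGeneratorValue.of_tendsto (hT.semigroup i) (Eventually.of_forall fun n => ?_) hu hv
  have hint : ∀ k, ∀ w ∈ W k, Integrable fun x =>
      (μ s (cubePoint a.frozen (thetaSeq n) (s / r) x) *
        w.2 s (cubePoint a.frozen (thetaSeq n) (s / r) x)) •
        diffList w.1 (s / r) (a.partialFun T f k)
          (cubePoint a.frozen (thetaSeq n) (s / r) x) := by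
    intro k w hw
    have hwfr : ∀ j ∈ w.1, j ∈ a.frozen := fun j hj =>
      a.diffs_subset j ((hW k w hw).1.subset hj)
    obtain ⟨C, hC⟩ :=
      a.exists_diffList_partialFun_bound hT ha hf k hwfr hσ (thetaSeq_pos n)
    exact integrable_smul_cubePoint (φ := fun τ => μ s τ * w.2 s τ) hσ.le
      ((hsym k w hw).1 s hs hs').continuous
      (continuousOn_diffList_orbitFun hT.semigroup a w.1 hσ.le f)
      (fun x => a.hasDerivAt_diffList_orbitFun hT hf (fun h => hκ k (hwfr _ h)) hσ.le
        (cubePoint_nonneg hσ.le (thetaSeq n) x)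
        ((mul_pos hσ (thetaSeq_pos n)).trans_le (le_cubePoint (thetaSeq n).2.2 hσ.le x (hκ k)))) hC
  have hlist := fun k => integral_list_map_sum (W k) (hint k)
  have hgen : ∀ x, IsGeneratorValue (T i)
      (μ s (cubePoint a.frozen (thetaSeq n) (s / r) x) •
        diffList a.diffs (s / r) (a.orbitFun T f) (cubePoint a.frozen (thetaSeq n) (s / r) x))
      (∑ k, ((W k).map fun w => (μ s (cubePoint a.frozen (thetaSeq n) (s / r) x) *
        w.2 s (cubePoint a.frozen (thetaSeq n) (s / r) x)) •
        diffList w.1 (s / r) (a.partialFun T f k)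
          (cubePoint a.frozen (thetaSeq n) (s / r) x)).sum) := by
    intro x
    have hF : ∀ τ ∈ {τ | (∀ i, τ i ∈ Icc 0 (s / r)) ∧
        ∀ i ∉ a.frozen, s / r * (thetaSeq n : ℝ) ≤ τ i},
        IsGeneratorValue (T i) (a.orbitFun T f τ)
          (∑ k, ((a.mult k : ℂ)⁻¹ * Z i k (a.argMap τ)) • a.partialFun T f k τ) := by
      intro τ hτ
      rw [a.orbitFun_eq]
      -- The times are at most `r * (r * (s / r)) = r * s ≤ r * s₀`, hence in the cube where the
      -- cut-off formula holds.
      have h1 := hform i f hf (a.argMap τ) fun j =>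
        ⟨a.argMap_nonneg (fun i => (hτ.1 i).1) j, (a.argMap_le hτ.1 j).trans (by
          rw [mul_div_cancel₀ _ hrpos.ne']
          exact mul_le_mul_of_nonneg_left hs' hrpos.le)⟩
      convert h1 using 2 with k
      have hk : (a.mult k : ℂ) ≠ 0 := by
        exact_mod_cast (Nat.one_le_iff_ne_zero.1 (a.one_le_mult k))
      rw [partialFun, ← Complex.coe_smul, smul_smul, Complex.ofReal_natCast, mul_comm (_⁻¹),
        inv_mul_cancel_right₀ hk]
    have h2 := (isGeneratorValue_diffList
      (fun j hj τ hτ => a.cube_update hσ.le (a.diffs_subset j hj) τ hτ) hF _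
      (a.cubePoint_mem_cube hσ.le (thetaSeq n) x)).smul
        (μ s (cubePoint a.frozen (thetaSeq n) (s / r) x))
    rw [diffList_sum, Finset.smul_sum] at h2
    convert h2 using 2 with k
    -- The Leibniz formula needs the difference variables to vanish; they are frozen, hence `0` at
    -- these points.
    rw [hWF k (a.partialFun T f k) s _ fun j hj => by simp [cubePoint, a.diffs_subset j hj],
      List.smul_sum, List.map_map]
    simp only [Function.comp_def, smul_smul]
  have hfin := (IsGeneratorValue.integral (hT.semigroup i)
    (a.integrable_term hT.semigroup hμc hσ.le (thetaSeq n) a.frozen a.diffs f) hgen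
    (integrable_finsetSum _ fun k _ => (hlist k).1)).real_smul ((s / r) ^ a.m)⁻¹
  rw [integral_finsetSum _ fun k _ => (hlist k).1, Finset.smul_sum] at hfin
  convert hfin using 2 with k
  rw [(hlist k).2, List.smul_sum, List.map_map]
  rfl

/-- Applying a generator to a sum of integrals gives a sum of integrals, with one more frozen
variable allowed. -/
theorem exists_generator_step (hT : Admissible T) (hr : 1 ≤ r)
    (hd : (d : ℝ) * (r * s₀) ^ 2 < 1) {n : ℕ} (hn : n < r) {A : ℝ → H → H}
    (hA : A ∈ termSums T r s₀ n) (i : Fin d) :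
    ∃ B ∈ termSums T r s₀ (n + 1), ∀ s, 0 < s → s ≤ s₀ → ∀ f,
      IsGeneratorValue (T i) (A s f) (B s f) := by
  have key : ∃ B ∈ termSums T r s₀ (n + 1), ∀ s, 0 < s → s ≤ s₀ → ∀ f ∈ sobolev T 1,
      IsGeneratorValue (T i) (A s f) (B s f) := by
    induction hA using AddSubmonoid.closure_induction with
    | mem A h =>
      obtain ⟨a, μ, ha, hμ, rfl⟩ := h
      obtain ⟨B, hB, hgen⟩ := a.exists_generator_step hT hr hd (ha.trans_lt hn) hμ i
      exact ⟨B, termSums_mono (Nat.succ_le_succ ha) hB, hgen⟩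
    | zero => exact ⟨0, zero_mem _, fun s _ _ f _ => IsGeneratorValue.zero⟩
    | add A₁ A₂ _ _ h₁ h₂ =>
      obtain ⟨B₁, hB₁, hgen₁⟩ := h₁
      obtain ⟨B₂, hB₂, hgen₂⟩ := h₂
      exact ⟨B₁ + B₂, add_mem hB₁ hB₂, fun s hs hs' f hf =>
        (hgen₁ s hs hs' f hf).add (hgen₂ s hs hs' f hf)⟩
  obtain ⟨B, hB, hgen⟩ := key
  refine ⟨B, hB, fun s hs hs' f => ?_⟩
  -- Both sides are continuous in `f`, so density of `H¹` and closedness of the generator remove the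
  -- restriction on `f`.
  have : (𝓝[sobolev T 1] f).NeBot := mem_closure_iff_nhdsWithin_neBot.1 (hT.dense_sobolev_one f)
  refine IsGeneratorValue.of_tendsto (l := 𝓝[sobolev T 1] f) (hT.semigroup i) ?_
    (((continuous_of_mem_termSums hT.semigroup hr hA hs hs').tendsto f).mono_left
      nhdsWithin_le_nhds)
    (((continuous_of_mem_termSums hT.semigroup hr hB hs hs').tendsto f).mono_left
      nhdsWithin_le_nhds)
  filter_upwards [self_mem_nhdsWithin] with g hg using hgen s hs hs' g hg

theorem exists_mixedDerivative (hT : Admissible T) (hr : 1 ≤ r)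
    (hd : (d : ℝ) * (r * s₀) ^ 2 < 1) {n : ℕ} {A : ℝ → H → H} (hA : A ∈ termSums T r s₀ n)
    (js : List (Fin d)) (hn : n + js.length ≤ r) :
    ∃ B ∈ termSums T r s₀ (n + js.length), ∀ s, 0 < s → s ≤ s₀ → ∀ f,
      IsMixedDerivative T js (A s f) (B s f) := by
  induction js with
  | nil => exact ⟨A, hA, fun s _ _ f => rfl⟩
  | cons j js ih =>
    rw [List.length_cons, ← add_assoc] at hn
    obtain ⟨B, hB, hgen⟩ := ih (Nat.le_of_succ_le hn)
    obtain ⟨C, hC, hgen'⟩ := exists_generator_step hT hr hd (Nat.lt_of_succ_le hn) hB j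
    exact ⟨C, hC, fun s hs hs' f => ⟨B s f, hgen s hs hs' f, hgen' s hs hs' f⟩⟩

theorem mem_sobolev_of_mem_termSums (hT : Admissible T) (hr : 1 ≤ r)
    (hd : (d : ℝ) * (r * s₀) ^ 2 < 1) {n p : ℕ} {A : ℝ → H → H} (hA : A ∈ termSums T r s₀ n)
    (hn : n + p ≤ r) {s : ℝ} (hs : 0 < s) (hs' : s ≤ s₀) (f : H) : A s f ∈ sobolev T p := by
  intro js hjs
  obtain ⟨B, -, hB⟩ := exists_mixedDerivative hT hr hd hA js ((Nat.add_le_add_left hjs n).trans hn)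
  exact ⟨_, hB s hs hs' f⟩

end Iteration

/-! ### Expanding the Hardy–Steklov operator -/

section Expansion

variable {d r : ℕ} {H : Type*} [NormedAddCommGroup H] [InnerProductSpace ℂ H] [CompleteSpace H]
  {T : Fin d → ℝ → H →L[ℂ] H}

omit [CompleteSpace H] in
theorem integral_apply_sum {S : ℝ → H →L[ℂ] H} (hS : IsContractionSemigroup S) {X Y : Type*}
    [TopologicalSpace X] [CompactSpace X] [MeasurableSpace X] [BorelSpace X]
    {m : Measure X} [IsFiniteMeasure m] {u : X → ℝ} (hu : Continuous u) (hu0 : ∀ x, 0 ≤ u x)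
    (W : Finset Y) (c : Y → ℝ) (v : Y → H) :
    ∫ x, S (u x) (∑ w ∈ W, c w • v w) ∂m = ∑ w ∈ W, c w • ∫ x, S (u x) (v w) ∂m := by
  have hlin : ∀ x, S (u x) (∑ w ∈ W, c w • v w) = ∑ w ∈ W, c w • S (u x) (v w) := by
    intro x
    rw [map_sum]
    refine Finset.sum_congr rfl fun w _ => ?_
    rw [← Complex.coe_smul, map_smul, Complex.coe_smul]
  have hc : ∀ w, Continuous fun x => S (u x) (v w) := fun w =>
    hS.continuous_apply hu continuous_const hu0
  simp only [hlin]
  rw [integral_finsetSum]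
  · exact Finset.sum_congr rfl fun w _ => integral_smul _ _
  · exact fun w _ => ((hc w).integrable_of_hasCompactSupport
      (HasCompactSupport.of_compactSpace _)).smul (c w)

omit [CompleteSpace H] in
theorem hardySteklovOne_eq {S : ℝ → H →L[ℂ] H} (hS : IsContractionSemigroup S) {s : ℝ}
    (hs : 0 < s / r) (g : H) : hardySteklovOne S r s g =
      ∑ k ∈ Finset.Icc 1 r, ((-1 : ℝ) ^ k * (r.choose k : ℝ)) •
        ∫ y : Fin r → unitInterval, S ((k : ℝ) * ∑ i, s / r * (y i : ℝ)) g := by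
  unfold hardySteklovOne
  rw [setIntegral_pi_Icc hs, Fintype.card_fin, inv_smul_smul₀ (by positivity), integral_finsetSum]
  · exact Finset.sum_congr rfl fun w _ => integral_smul _ _
  · refine fun k _ => (integrable_cube ?_).smul _
    refine hS.continuous_apply (by fun_prop) continuous_const fun y => ?_
    exact mul_nonneg (Nat.cast_nonneg _) (Finset.sum_nonneg fun i _ => mul_nonneg hs.le (y i).2.1)

/-- The times at which the semigroups are evaluated, for independent rows of variables. -/
def rowTimes (m : Fin d → ℕ) (σ : ℝ) (X : Fin d → Fin r → unitInterval) (j : Fin d) : ℝ :=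
  (m j : ℝ) * ∑ i, σ * (X j i : ℝ)

theorem continuous_rowTimes (m : Fin d → ℕ) (σ : ℝ) :
    Continuous (rowTimes m σ : (Fin d → Fin r → unitInterval) → Fin d → ℝ) := by
  unfold rowTimes
  fun_prop

theorem rowTimes_nonneg (m : Fin d → ℕ) {σ : ℝ} (hσ : 0 ≤ σ) (X : Fin d → Fin r → unitInterval)
    (j : Fin d) : 0 ≤ rowTimes m σ X j :=
  mul_nonneg (Nat.cast_nonneg _) (Finset.sum_nonneg fun i _ => mul_nonneg hσ (X j i).2.1)

omit [CompleteSpace H] in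
theorem continuous_orbitList_rowTimes (hT : ∀ i, IsContractionSemigroup (T i))
    (l : List (Fin d)) (m : Fin d → ℕ) {σ : ℝ} (hσ : 0 ≤ σ) (f : H) :
    Continuous fun X : Fin d → Fin r → unitInterval => orbitList T l (rowTimes m σ X) f :=
  continuousOn_univ.1 (continuousOn_orbitList hT l (continuous_rowTimes m σ).continuousOn
    continuousOn_const fun X _ => rowTimes_nonneg m hσ X)

/-- Since `j ∉ l`, row `j` of `X` is a dummy in the inner integral. Replacing it by the independent
copy `y` and using Fubini merges the two integrals. -/
theorem integral_apply_integral_orbitList (hT : ∀ i, IsContractionSemigroup (T i))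
    {l : List (Fin d)} {j : Fin d} (hj : j ∉ l) (m : Fin d → ℕ) (k : ℕ) {σ : ℝ} (hσ : 0 ≤ σ)
    (f : H) :
    ∫ y : Fin r → unitInterval, T j ((k : ℝ) * ∑ i, σ * (y i : ℝ))
      (∫ X : Fin d → Fin r → unitInterval, orbitList T l (rowTimes m σ X) f) =
    ∫ X : Fin d → Fin r → unitInterval,
      orbitList T (j :: l) (rowTimes (Function.update m j k) σ X) f := by
  have hy0 : ∀ y : Fin r → unitInterval, 0 ≤ (k : ℝ) * ∑ i, σ * (y i : ℝ) := fun y =>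
    mul_nonneg (Nat.cast_nonneg _) (Finset.sum_nonneg fun i _ => mul_nonneg hσ (y i).2.1)
  have hint : ∀ (l : List (Fin d)) (m : Fin d → ℕ),
      Integrable fun X : Fin d → Fin r → unitInterval => orbitList T l (rowTimes m σ X) f :=
    fun l m => (continuous_orbitList_rowTimes hT l m hσ f).integrable_of_hasCompactSupport
      (HasCompactSupport.of_compactSpace _)
  have hcont : Continuous fun q : (Fin r → unitInterval) × (Fin d → Fin r → unitInterval) =>
      T j ((k : ℝ) * ∑ i, σ * (q.1 i : ℝ)) (orbitList T l (rowTimes m σ q.2) f) :=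
    (hT j).continuous_apply (by fun_prop)
      ((continuous_orbitList_rowTimes hT l m hσ f).comp continuous_snd) fun q => hy0 q.1
  have hupd : ∀ (X : Fin d → Fin r → unitInterval) (y : Fin r → unitInterval),
      orbitList T (j :: l) (rowTimes (Function.update m j k) σ (Function.update X j y)) f =
        T j ((k : ℝ) * ∑ i, σ * (y i : ℝ)) (orbitList T l (rowTimes m σ X) f) := by
    intro X y
    rw [orbitList_cons, orbitList_congr (t' := rowTimes m σ X)]
    · simp [rowTimes]
    · intro i hi
      have : i ≠ j := fun h => hj (h ▸ hi)
      simp [rowTimes, this]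
  have h1 := integral_pi_update (fun _ : Fin d => (volume : Measure (Fin r → unitInterval))) j
    (hint (j :: l) (Function.update m j k))
  simp only [hupd] at h1
  rw [← volume_pi] at h1
  rw [h1, ← integral_integral_swap]
  · refine integral_congr_ae (Eventually.of_forall fun y => ?_)
    exact ((T j _).integral_comp_comm (hint l m)).symm
  · exact hcont.integrable_of_hasCompactSupport (HasCompactSupport.of_compactSpace _)

/-- Expansion of products of the operators `hardySteklovOne` into integrals of products of the
semigroups. -/
theorem exists_expansion (hT : ∀ i, IsContractionSemigroup (T i)) (hr : 1 ≤ r)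
    {l : List (Fin d)} (hl : l.Nodup) :
    ∃ (Y : Type) (_ : Fintype Y) (c : Y → ℝ) (m : Y → Fin d → ℕ),
      (∀ w j, 1 ≤ m w j ∧ m w j ≤ r) ∧ ∀ s : ℝ, 0 < s → ∀ f : H,
        l.foldr (fun j g => hardySteklovOne (T j) r s g) f =
          ∑ w, c w • ∫ X : Fin d → Fin r → unitInterval,
            orbitList T l (rowTimes (m w) (s / r) X) f := by
  induction l with
  | nil =>
    exact ⟨Unit, inferInstance, fun _ => 1, fun _ _ => 1, fun _ _ => ⟨le_rfl, hr⟩,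
      fun s _ f => by simp⟩
  | cons j l ih =>
    rw [List.nodup_cons] at hl
    obtain ⟨Y, hY, c, m, hm, hexp⟩ := ih hl.2
    refine ⟨(Finset.Icc 1 r : Finset ℕ) × Y, instFintypeProd _ _,
      fun p => ((-1 : ℝ) ^ (p.1 : ℕ) * (r.choose p.1 : ℝ)) * c p.2,
      fun p => Function.update (m p.2) j p.1, fun p i => ?_, fun s hs f => ?_⟩
    · rcases eq_or_ne i j with rfl | hi
      · simpa using Finset.mem_Icc.1 p.1.2
      · simpa [hi] using hm p.2 i
    · have hσ : 0 < s / r := div_pos hs (by exact_mod_cast hr)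
      rw [List.foldr_cons, hexp s hs f, hardySteklovOne_eq (hT j) hσ, Fintype.sum_prod_type,
        ← Finset.sum_coe_sort (Finset.Icc 1 r)]
      refine Finset.sum_congr rfl fun k _ => ?_
      rw [integral_apply_sum (hT j) (by fun_prop) (fun y => mul_nonneg (Nat.cast_nonneg _)
        (Finset.sum_nonneg fun i _ => mul_nonneg hσ.le (y i).2.1)), Finset.smul_sum]
      refine Finset.sum_congr rfl fun w _ => ?_
      rw [integral_apply_integral_orbitList hT hl.1 (m w) k hσ.le f, smul_smul]

theorem exists_mem_termSums_eq_hardySteklov (hT : ∀ i, IsContractionSemigroup (T i))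
    (hr : 1 ≤ r) (s₀ : ℝ) :
    ∃ A ∈ termSums T r s₀ 0, ∀ s : ℝ, 0 < s → ∀ f, A s f = hardySteklov T r s f := by
  obtain ⟨Y, _, c, m, hm, hexp⟩ := exists_expansion (r := r) hT hr (List.nodup_finRange d)
  let a : Y → TermIndex d r := fun w =>
    { mult := m w
      one_le_mult := fun j => (hm w j).1
      mult_le := fun j => (hm w j).2
      frozen := ∅
      diffs := []
      diffs_nodup := List.nodup_nil
      diffs_subset := fun x hx => by simp at hx }
  refine ⟨∑ w, fun s f => (a w).integralTerm T (fun _ => (c w : ℂ)) s f, sum_mem fun w _ =>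
    integralTerm_mem_termSums (μ := fun _ _ => (c w : ℂ)) (a w) le_rfl (isSymbol_const _),
    fun s hs f => ?_⟩
  have hσ : 0 < s / r := div_pos hs (by exact_mod_cast hr)
  rw [hardySteklov, hexp s hs f]
  simp only [Finset.sum_apply]
  refine Finset.sum_congr rfl fun w _ => ?_
  have ham : (a w).m = 0 := rfl
  have hcont := integrable_cube (E := H) ((continuous_comp_cubePoint (M := (a w).frozen) hσ.le
    ((a w).continuousOn_orbitFun hT f)).comp (Continuous.prodMk_right 0))
  rw [(a w).integralTerm_eq hT continuous_const hσ, ham, pow_zero, inv_one, one_smul]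
  simp only [Complex.coe_smul]
  rw [integral_smul]
  congr 1
  have hmp := measurePreserving_uncurry (ι := Fin d) (κ := Fin r)
    (volume : Measure unitInterval)
  have hint : Integrable (fun x : Fin d × Fin r → unitInterval =>
      (a w).orbitFun T f (cubePoint (a w).frozen 0 (s / r) x))
      (Measure.pi fun _ : Fin d × Fin r => (volume : Measure unitInterval)) := by
    exact hcont
  change ∫ x, (a w).orbitFun T f (cubePoint (a w).frozen 0 (s / r) x)
    ∂(Measure.pi fun _ : Fin d × Fin r => (volume : Measure unitInterval)) = _
  rw [← hmp.map_eq, integral_map hmp.measurable.aemeasurable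
    (by rw [hmp.map_eq]; exact hint.aestronglyMeasurable)]
  refine integral_congr_ae (Eventually.of_forall fun X => ?_)
  simp only [TermIndex.orbitFun, orbit_eq_orbitList]
  refine congrArg (fun t => orbitList T (List.finRange d) t f) ?_
  funext j
  simp [a, rowTimes, cubePoint]

end Expansion

end HardySteklov

/-! ### Assembly of the theorem -/

theorem theorem3p1 {H : Type*} [NormedAddCommGroup H] [InnerProductSpace ℂ H] [CompleteSpace H]
    {d : ℕ} (T : Fin d → ℝ → H →L[ℂ] H) (hT : HardySteklov.Admissible T) (r : ℕ) (hr : 1 ≤ r) :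
    (∀ (f : H) (s : ℝ), 0 < s → (d : ℝ) * (r * s) ^ 2 < 1 →
      HardySteklov.hardySteklov T r s f ∈ HardySteklov.sobolev T r) ∧
    ∀ (q : ℕ), q ≤ r → ∀ (j : Fin q → Fin d) (s₀ : ℝ), 0 < s₀ → (d : ℝ) * (r * s₀) ^ 2 < 1 →
      ∃ (N : ℕ) (a : Fin N → ℂ) (idx : Fin N → HardySteklov.TermIndex d r)
        (μ : Fin N → ℝ → (Fin d × Fin r → ℝ) → ℂ) (c : ℕ → ℝ),
        (∀ (ν : Fin N) (s : ℝ), 0 < s → s ≤ s₀ →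
          ContDiff ℝ ∞ (μ ν s) ∧
          ∀ (p : ℕ) (τ : Fin d × Fin r → ℝ), (∀ x, τ x ∈ Icc (0 : ℝ) s) →
            ‖iteratedFDeriv ℝ p (μ ν s) τ‖ ≤ c p * s ^ ((idx ν).m - (idx ν).l)) ∧
        ∀ (f : H) (s : ℝ), 0 < s → s ≤ s₀ →
          HardySteklov.IsMixedDerivative T (List.ofFn j) (HardySteklov.hardySteklov T r s f)
            (∑ ν, a ν • (idx ν).integralTerm T (μ ν s) s f) ∧
          (∑ ν, a ν • (idx ν).integralTerm T (μ ν s) s f) ∈ HardySteklov.sobolev T (r - q) ∧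
          ∀ ν, (idx ν).integralTerm T (μ ν s) s f ∈ HardySteklov.sobolev T (r - q) := by
  have hsg := hT.semigroup
  refine ⟨fun f s hs hd => ?_, fun q hq j s₀ hs₀ hd => ?_⟩
  -- For the first claim `s` itself serves as `s₀`.
  · obtain ⟨A, hA, hAeq⟩ := HardySteklov.exists_mem_termSums_eq_hardySteklov hsg hr s
    rw [← hAeq s hs f]
    exact HardySteklov.mem_sobolev_of_mem_termSums hT hr hd hA (by simp) hs le_rfl f
  · obtain ⟨A, hA, hAeq⟩ := HardySteklov.exists_mem_termSums_eq_hardySteklov hsg hr s₀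
    obtain ⟨B, hB, hmix⟩ := HardySteklov.exists_mixedDerivative hT hr hd hA (List.ofFn j)
      (by simpa using hq)
    rw [List.length_ofFn, zero_add] at hB
    obtain ⟨W, hW, hWB⟩ := AddSubmonoid.exists_list_of_mem_closure hB
    choose idx μ hm hμ hterm using fun ν : Fin W.length => hW _ (W.get_mem ν)
    choose c hc using fun ν => (hμ ν).2
    have hqr : q + (r - q) ≤ r := by omega
    have hsum : ∀ s f, ∑ ν, (1 : ℂ) • (idx ν).integralTerm T (μ ν s) s f = B s f := by
      intro s f
      have h1 : B = ∑ ν, W.get ν := by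
        rw [← hWB, ← List.sum_ofFn, List.ofFn_get]
      rw [h1, Finset.sum_apply, Finset.sum_apply]
      refine Finset.sum_congr rfl fun ν _ => ?_
      rw [one_smul, hterm ν]
    -- The scalars are already absorbed in the coefficients `μ`, so `a_ν = 1`; summing `|c ν p|`
    -- gives one constant valid for every term.
    refine ⟨W.length, fun _ => 1, idx, μ, fun p => ∑ ν, |c ν p|, fun ν s hs hs' =>
      ⟨(hμ ν).1 s hs hs', fun p τ _ => ?_⟩, fun f s hs hs' => ?_⟩
    · refine (hc ν p s hs hs' τ).trans (mul_le_mul_of_nonneg_right ?_ (by positivity))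
      exact (le_abs_self _).trans (Finset.single_le_sum (f := fun ν => |c ν p|)
        (fun _ _ => abs_nonneg _) (Finset.mem_univ ν))
    · rw [hsum, ← hAeq s hs f]
      exact ⟨hmix s hs hs' f, HardySteklov.mem_sobolev_of_mem_termSums hT hr hd hB hqr hs hs' f,
        fun ν => HardySteklov.mem_sobolev_of_mem_termSums hT hr hd
          (HardySteklov.integralTerm_mem_termSums (idx ν) (hm ν) (hμ ν)) hqr hs hs' f⟩
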